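/- Let $\mathcal H$ be a complex Hilbert space (inner product linear in the second argument), let $A$ and $B$ be (possibly unbounded) self-adjoint operators on $\mathcal H$ with spectral measures $E_A$, $E_B$, and write $e^{-isA}=\int e^{-isa}\,dE_A(a)$, and similarly for $B$. Suppose that $B$ has finite spectrum $\sigma(B)$ and is non-degenerate, i.e. each $b\in\sigma(B)$ has a one-dimensional eigenspace; let $|b\rangle$ be a unit vector in it, so that $B=\sum_{b\in\sigma(B)} b\,|b\rangle\langle b|$. Let $\phi\in\mathcal H$, $\phi\neq 0$, satisfy $\langle b,\phi\rangle\neq 0$ for all $b\in\sigma(B)$. A quasi-probability measure is a complex measure of total mass $1$; identify $s=s_1+is_2\in\mathbb C$ with $(s_1,s_2)\in\mathbb R^2$, put $\langle s,a\rangle=s_1a_1+s_2a_2$, and for a complex measure $\mu$ on $\mathbb C\times\mathbb R$ put $(\mathscr F\mu)(s,t)=\int e^{-i(\langle s,a\rangle+tb)}\,d\mu(a,b)$. Let $\mu_B^\phi(\Delta)=\langle\phi,E_B(\Delta)\phi\rangle/\|\phi\|^2$ and, for $b\in\sigma(B)$, $\nu_b(\Delta)=\langle b,E_A(\Delta)\phi\rangle/\langle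 b,\phi\rangle$. Let $\nu_b^*$ be the complex conjugate of $\nu_b$, and let $\tilde K(b,\cdot)=\nu_b^*\otimes\nu_b$ (a complex measure on $\mathbb R^2\cong\mathbb C$) for $b\in\sigma(B)$ and $\tilde K(b,\cdot)=\delta_0$ for $b\in\mathbb R\setminus\sigma(B)$. Then: 1. For every Borel set $\Delta_A\subseteq\mathbb R$, $b\mapsto\nu_b(\Delta_A)$ is the Radon–Nikodým derivative of $\Delta\mapsto\langle\phi,E_B(\Delta)E_A(\Delta_A)\phi\rangle/\|\phi\|^2$ with respect to $\mu_B^\phi$, and $\tilde K$ is a transition quasi-probability kernel: $b\mapsto\tilde K(b,\Delta)$ is Borel measurable for each Borel $\Delta\subseteq\mathbb C$, and each $\tilde K(b,\cdot)$ is a quasi-probability measure. 2. There is a quasi-probability measure $\tilde\mu$ on $\mathbb C\times\mathbb R$ such that $$\int f\,d\tilde\mu=\int_{\mathbb R}\int_{\mathbb C}f(a,b)\,\tilde K(b,da)\,d\mu_B^\phi(b)$$ for all Borel $f:\mathbb C\times\mathbb R\to\mathbb C$ for which the right-hand side converges absolutely (such $f$ being $\tilde\mu$-integrable), and its Fourier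 transform is the auxiliary distribution, $$(\mathscr F\tilde\mu)(s,t)=\frac{\langle\phi,e^{-is_1A}e^{-itB}e^{-is_2A}\phi\rangle}{\|\phi\|^2},\qquad s\in\mathbb C,\ t\in\mathbb R.$$ 3. Every member of the convolutive family admits representation by a quasi-probability measure, namely a linear image of $\tilde\mu$: for every $\alpha=\alpha_1+i\alpha_2\in\mathbb C$, with $$T_\alpha=\begin{pmatrix}(1-\alpha_1)/2&(1+\alpha_1)/2\\-\alpha_2/2&\alpha_2/2\end{pmatrix},$$ the image $\tilde\mu_{(T_\alpha\times I)}$ of $\tilde\mu$ under $(a,b)\mapsto(T_\alpha a,b)$ is a quasi-probability measure and $$(\mathscr F\tilde\mu_{(T_\alpha\times I)})(s,t)=\frac{\langle\phi,e^{-i\langle s,(1-\alpha)/2\rangle A}\,e^{-itB}\,e^{-i\langle s,(1+\alpha)/2\rangle A}\phi\rangle}{\|\phi\|^2},\qquad s\in\mathbb C,\ t\in\mathbb R.$$ -/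

import Mathlib

open MeasureTheory
open scoped ENNReal InnerProductSpace

noncomputable section

namespace QJP

/-! ### Possibly unbounded operators on a Hilbert space -/

section Operators

variable {H : Type*} [NormedAddCommGroup H] [InnerProductSpace ℂ H]

/-- The resolvent set of a partially defined operator `T`: the `z` for which `T - z` has an
everywhere defined bounded two-sided inverse. -/
def resolventSet (T : H →ₗ.[ℂ] H) : Set ℂ :=
  {z | ∃ R : H →L[ℂ] H,
    (∀ y : H, ∃ h : R y ∈ T.domain, T ⟨R y, h⟩ - z • R y = y) ∧
    ∀ x : T.domain, R (T x - z • (x : H)) = x}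

/-- The spectrum of a partially defined operator. -/
def spectrum (T : H →ₗ.[ℂ] H) : Set ℂ := (resolventSet T)ᶜ

/-- The eigenspace `{x ∈ dom T | T x = z x}`. -/
def eigenspace (T : H →ₗ.[ℂ] H) (z : ℂ) : Submodule ℂ H :=
  (LinearMap.ker (T.toFun - z • T.domain.subtype)).map T.domain.subtype

end Operators

/-! ### Spectral measures and the spectral measure of a self-adjoint operator -/

/-- Spectral measures (projection-valued measures) on the Borel sets of the real line. As for
Mathlib's vector measures, the value on a non-measurable set is `0` by convention. -/
structure SpectralMeasure (H : Type*) [NormedAddCommGroup H] [InnerProductSpace ℂ H]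
    [CompleteSpace H] where
  /-- the projection attached to a Borel set -/
  toFun : Set ℝ → H →L[ℂ] H
  isStarProjection' : ∀ Δ, MeasurableSet Δ → IsStarProjection (toFun Δ)
  not_measurable' : ∀ Δ, ¬ MeasurableSet Δ → toFun Δ = 0
  empty' : toFun ∅ = 0
  univ' : toFun Set.univ = 1
  iUnion' : ∀ Δ : ℕ → Set ℝ, (∀ n, MeasurableSet (Δ n)) →
    Pairwise (Function.onFun Disjoint Δ) →
    ∀ x : H, HasSum (fun n => toFun (Δ n) x) (toFun (⋃ n, Δ n) x)

section Spectral

variable {H : Type*} [NormedAddCommGroup H] [InnerProductSpace ℂ H] [CompleteSpace H]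

namespace SpectralMeasure

instance : CoeFun (SpectralMeasure H) (fun _ => Set ℝ → H →L[ℂ] H) := ⟨SpectralMeasure.toFun⟩

/-- The point mass at the origin, which only serves to show that spectral measures exist. -/
instance : Nonempty (SpectralMeasure H) := by
  classical
  refine ⟨{ toFun := fun Δ => if MeasurableSet Δ ∧ (0 : ℝ) ∈ Δ then 1 else 0
            isStarProjection' := fun Δ _ => ?_
            not_measurable' := fun Δ h => by simp [h]
            empty' := by simp
            univ' := by simp
            iUnion' := fun Δ hm hd x => ?_ }⟩
  · split_ifs
    · exact .one _
    · exact .zero _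
  · by_cases h : ∃ n, (0 : ℝ) ∈ Δ n
    · obtain ⟨n, hn⟩ := h
      have h1 : MeasurableSet (⋃ n, Δ n) ∧ (0 : ℝ) ∈ ⋃ n, Δ n :=
        ⟨MeasurableSet.iUnion hm, Set.mem_iUnion.2 ⟨n, hn⟩⟩
      have h2 : (if MeasurableSet (⋃ n, Δ n) ∧ (0 : ℝ) ∈ ⋃ n, Δ n
          then (1 : H →L[ℂ] H) else 0) x
          = (if MeasurableSet (Δ n) ∧ (0 : ℝ) ∈ Δ n then (1 : H →L[ℂ] H) else 0) x := by
        rw [if_pos h1, if_pos ⟨hm n, hn⟩]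
      rw [h2]
      refine hasSum_single n fun m hmn => ?_
      have h3 : (0 : ℝ) ∉ Δ m := fun h0 => Set.disjoint_left.1 (hd hmn) h0 hn
      simp [h3]
    · have h' : ∀ n, (0 : ℝ) ∉ Δ n := fun n hn => h ⟨n, hn⟩
      simp [h']

/-- The complex measure `Δ ↦ ⟨x, E(Δ) y⟩`. -/
def innerMeasure (E : SpectralMeasure H) (x y : H) : ComplexMeasure ℝ where
  measureOf' Δ := ⟪x, E Δ y⟫_ℂ
  empty' := by simp [E.empty']
  not_measurable' Δ h := by simp [E.not_measurable' Δ h]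
  m_iUnion' Δ hm hd := (innerSL ℂ x).hasSum (E.iUnion' Δ hm hd y)

/-- The finite positive measure `Δ ↦ ⟨x, E(Δ) x⟩ = ‖E(Δ) x‖²`. -/
def normSqMeasure (E : SpectralMeasure H) (x : H) : Measure ℝ :=
  Measure.ofMeasurable (fun Δ _ => ENNReal.ofReal (⟪x, E Δ x⟫_ℂ).re)
    (by simp [E.empty'])
    (by
      intro Δ hm hd
      have h0 : ∀ n, 0 ≤ (⟪x, E (Δ n) x⟫_ℂ).re := by
        intro n
        have hp := (ContinuousLinearMap.IsPositive.of_isStarProjection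
          (E.isStarProjection' (Δ n) (hm n)))
        exact hp.re_inner_nonneg_right x
      have h1 : HasSum (fun n => (⟪x, E (Δ n) x⟫_ℂ).re) (⟪x, E (⋃ n, Δ n) x⟫_ℂ).re :=
        Complex.hasSum_re ((innerSL ℂ x).hasSum (E.iUnion' Δ hm hd x))
      rw [← h1.tsum_eq, ENNReal.ofReal_tsum_of_nonneg h0 h1.summable])

end SpectralMeasure

/-- Integral of a complex function against a complex measure. -/
def cintegral {X : Type*} [MeasurableSpace X] (μ : ComplexMeasure X) (f : X → ℂ) : ℂ :=
  μ.integral f (ContinuousLinearMap.mul ℝ ℂ)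

/-- `A = ∫ a dE(a)`: the domain of `A` consists of the `x` with `∫ a² d⟨x, E(a) x⟩ < ∞`, and
`⟨y, A x⟩ = ∫ a d⟨y, E(a) x⟩` for all `x ∈ dom A` and all `y`. -/
def IsSpectralMeasureOf (E : SpectralMeasure H) (A : H →ₗ.[ℂ] H) : Prop :=
  (∀ x : H, x ∈ A.domain ↔ ∫⁻ a, ENNReal.ofReal (a ^ 2) ∂(E.normSqMeasure x) < ∞) ∧
  ∀ (x : A.domain) (y : H), ⟪y, A x⟫_ℂ = cintegral (E.innerMeasure y x) (fun a => (a : ℂ))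

/-- The spectral measure `E_A` of a self-adjoint operator `A`, i.e. the unique spectral measure
with `A = ∫ a dE_A(a)` (an arbitrary spectral measure if `A` is not self-adjoint). -/
def spectralMeasure (A : H →ₗ.[ℂ] H) : SpectralMeasure H :=
  Classical.epsilon fun E => IsSpectralMeasureOf E A

open Classical in
/-- The bounded operator `f(A) = ∫ f dE_A` for a bounded Borel function `f`, i.e. the unique
bounded operator `T` with `⟨x, T y⟩ = ∫ f d⟨x, E_A y⟩` for all `x`, `y`. -/
def boundedFunctionalCalculus (A : H →ₗ.[ℂ] H) (f : ℝ → ℂ) : H →L[ℂ] H :=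
  if h : ∃ T : H →L[ℂ] H, ∀ x y : H,
      ⟪x, T y⟫_ℂ = cintegral ((spectralMeasure A).innerMeasure x y) f
  then h.choose else 0

/-- The unitary operator `e^{-isA}`. -/
def expNegI (A : H →ₗ.[ℂ] H) (s : ℝ) : H →L[ℂ] H :=
  boundedFunctionalCalculus A fun a => Complex.exp (-Complex.I * (s * a))

/-- The probability measure `μ_B^φ(Δ) = ⟨φ, E_B(Δ) φ⟩ / ‖φ‖²` of the outcomes of `B` in the
state `φ`. -/
def bornMeasure (B : H →ₗ.[ℂ] H) (φ : H) : Measure ℝ :=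
  ENNReal.ofReal (‖φ‖ ^ 2)⁻¹ • (spectralMeasure B).normSqMeasure φ

end Spectral

/-! ### Quasi-probability measures, kernels, Fourier transform -/

/-- A complex measure of total mass one. -/
def IsQuasiProbability {X : Type*} [MeasurableSpace X] (μ : ComplexMeasure X) : Prop :=
  μ Set.univ = 1

/-- The complex conjugate `μ*(Δ) = μ(Δ)*`. -/
def conjMeasure {X : Type*} [MeasurableSpace X] (μ : ComplexMeasure X) : ComplexMeasure X :=
  μ.mapRange (starRingEnd ℂ : ℂ →+* ℂ).toAddMonoidHom Complex.continuous_conj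

/-- A transition quasi-probability kernel. -/
def IsQuasiProbabilityKernel {X Y : Type*} [MeasurableSpace X] [MeasurableSpace Y]
    (K : X → ComplexMeasure Y) : Prop :=
  (∀ Δ, MeasurableSet Δ → Measurable fun x => K x Δ) ∧ ∀ x, IsQuasiProbability (K x)

/-- `π` is the complex measure on `Y × X` built from the kernel `K` and the measure `μ`:
`∫ f dπ = ∫ (∫ f(y, x) K(x, dy)) dμ(x)` for every measurable `f` for which the iterated integral
converges absolutely. -/
def IsKernelProduct {X Y : Type*} [MeasurableSpace X] [MeasurableSpace Y]
    (K : X → ComplexMeasure Y) (μ : Measure X) (π : ComplexMeasure (Y × X)) : Prop :=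
  ∀ f : Y × X → ℂ, Measurable f →
    ∫⁻ x, ∫⁻ y, ‖f (y, x)‖ₑ ∂(K x).variation ∂μ < ∞ →
    π.Integrable f ∧ cintegral π f = ∫ x, cintegral (K x) (fun y => f (y, x)) ∂μ

/-- The scalar product of two complex numbers seen as vectors of `ℝ²`. -/
def dot (s a : ℂ) : ℝ := s.re * a.re + s.im * a.im

/-- The Fourier transform `∫ e^{-i(⟨s,a⟩ + t b)} dμ(a, b)` of a complex measure on `ℂ × ℝ`. -/
def fourier (μ : ComplexMeasure (ℂ × ℝ)) (s : ℂ) (t : ℝ) : ℂ :=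
  cintegral μ fun p => Complex.exp (-Complex.I * ((dot s p.1 + t * p.2 : ℝ) : ℂ))

/-- The distribution with Fourier transform `u` is represented by the quasi-probability
measure `μ`. -/
def Represents (μ : ComplexMeasure (ℂ × ℝ)) (u : ℂ → ℝ → ℂ) : Prop :=
  IsQuasiProbability μ ∧ ∀ s t, fourier μ s t = u s t

/-- The linear map of `ℝ² ≅ ℂ` with matrix
`T_α = !![(1 - α₁)/2, (1 + α₁)/2; -α₂/2, α₂/2]`, where `α = α₁ + i α₂`. -/
def paramMap (α a : ℂ) : ℂ :=
  ⟨(1 - α.re) / 2 * a.re + (1 + α.re) / 2 * a.im, -α.im / 2 * a.re + α.im / 2 * a.im⟩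

/-- `(T_α × I)(a, b) = (T_α a, b)`. -/
def paramMapProd (α : ℂ) (p : ℂ × ℝ) : ℂ × ℝ := (paramMap α p.1, p.2)

section Quantum

variable {H : Type*} [NormedAddCommGroup H] [InnerProductSpace ℂ H] [CompleteSpace H]

/-- The auxiliary distribution `⟨φ, e^{-is₁A} e^{-itB} e^{-is₂A} φ⟩ / ‖φ‖²`, `s = s₁ + i s₂`. -/
def auxDistribution (A B : H →ₗ.[ℂ] H) (φ : H) (s : ℂ) (t : ℝ) : ℂ :=
  ⟪φ, expNegI A s.re (expNegI B t (expNegI A s.im φ))⟫_ℂ / ((‖φ‖ ^ 2 : ℝ) : ℂ)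

/-- The hashed operator `e^{-i⟨s,(1-α)/2⟩A} e^{-itB} e^{-i⟨s,(1+α)/2⟩A}`. -/
def convolutiveHash (A B : H →ₗ.[ℂ] H) (α s : ℂ) (t : ℝ) : H →L[ℂ] H :=
  expNegI A (dot s ((1 - α) / 2)) ∘L expNegI B t ∘L expNegI A (dot s ((1 + α) / 2))

/-- The Fourier transform `⟨φ, #(s,t) φ⟩ / ‖φ‖²` of the member with parameter `α` of the
convolutive family of quasi-joint-probability distributions of `A` and `B` on `φ`. -/
def convolutiveDistribution (A B : H →ₗ.[ℂ] H) (φ : H) (α s : ℂ) (t : ℝ) : ℂ :=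
  ⟪φ, convolutiveHash A B α s t φ⟫_ℂ / ((‖φ‖ ^ 2 : ℝ) : ℂ)

/-- `ν_b(Δ) = ⟨b, E_A(Δ) φ⟩ / ⟨b, φ⟩`, with the eigenvector `|b⟩` written `v`. -/
def condMeasure (A : H →ₗ.[ℂ] H) (φ v : H) : ComplexMeasure ℝ :=
  (⟪v, φ⟫_ℂ)⁻¹ • (spectralMeasure A).innerMeasure v φ

/-- The product complex measure `ν_b* ⊗ ν_b` on `ℝ² ≅ ℂ`. -/
def condProduct (A : H →ₗ.[ℂ] H) (φ v : H) : ComplexMeasure ℂ :=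
  ((conjMeasure (condMeasure A φ v)).prod (condMeasure A φ v)
    (ContinuousLinearMap.mul ℝ ℂ)).map Complex.measurableEquivRealProd.symm

open Classical in
/-- The kernel `b ↦ ν_b* ⊗ ν_b` for `b ∈ σ(B)`, extended by the point mass at the origin to
`b ∉ σ(B)`; `e b` is a unit eigenvector for `b ∈ σ(B)`. -/
def condKernel (A B : H →ₗ.[ℂ] H) (e : ℝ → H) (φ : H) (b : ℝ) : ComplexMeasure ℂ :=
  if (b : ℂ) ∈ spectrum B then condProduct A φ (e b) else VectorMeasure.dirac 0 1

end Quantum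

end QJP

end

/-! Since `B` is non-degenerate, `e^{-itB} = ∑_b e^{-itb} |b⟩⟨b|` with rank-one terms, so `⟨φ,
e^{-is₁A} e^{-itB} e^{-is₂A} φ⟩ = ∑_b e^{-itb} ⟨φ, e^{-is₁A} b⟩ ⟨b, e^{-is₂A} φ⟩`. Each summand
factors into a function of `s₁`, a function of `s₂` and a function of `t`. Up to the weight `|⟨b,
φ⟩|²`, the first two are the Fourier transforms of `ν_b*` and `ν_b`. The finite sum `jointMeasure`
of the measures `(ν_b* ⊗ ν_b) ⊗ δ_b`, weighted by the Born probabilities, therefore has the required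
transform (`cintegral_jointMeasure_exp`). The convolutive family follows because pushing forward by
`T_α` acts on the frequency by the transpose (`dot_paramMap`).

Two facts about `B` support this. First, the eigenvectors are complete: the resolvent at a real
point outside the finite spectrum is bounded, self-adjoint and injective, and it is annihilated by a
polynomial with simple roots (`iSup_eigenspace_eq_top`). Second, `E_B`, which is only a choice among
the spectral measures representing `B`, must be the sum of the `|b⟩⟨b|`
(`IsEigenbasis.eq_spectralMeasure`). For `A`, the axioms of a projection-valued measure suffice to
integrate bounded functions (`exists_integral`). -/

noncomputable section

namespace QJP

/-! ### Integration against complex measures. -/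

section Integration

open Filter Topology

variable {X Y : Type*} [MeasurableSpace X] [MeasurableSpace Y]

/-- The variation is at most the sum of the total variations of the real and imaginary parts.
Finiteness is what makes every bounded measurable function integrable. -/
instance isFiniteMeasure_variation (μ : ComplexMeasure X) : IsFiniteMeasure μ.variation := by
  have h : μ.variation ≤ (ComplexMeasure.re μ).totalVariation
      + (ComplexMeasure.im μ).totalVariation := by
    refine VectorMeasure.variation_le_of_forall_enorm_le fun s _ => ?_
    have h1 := SignedMeasure.enorm_le_totalVariation (ComplexMeasure.re μ) s
    have h2 := SignedMeasure.enorm_le_totalVariation (ComplexMeasure.im μ) s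
    have h3 : ‖μ s‖ₑ ≤ ‖(μ s).re‖ₑ + ‖(μ s).im‖ₑ := by
      simp only [enorm_eq_nnnorm]
      exact_mod_cast Complex.norm_le_abs_re_add_abs_im (μ s)
    exact h3.trans (add_le_add h1 h2)
  exact isFiniteMeasure_of_le _ h

theorem integrable_of_bounded (μ : ComplexMeasure X) {f : X → ℂ} (hf : Measurable f) {C : ℝ}
    (hC : ∀ x, ‖f x‖ ≤ C) : μ.Integrable f :=
  Integrable.of_bound hf.aestronglyMeasurable C (Eventually.of_forall hC)

/-- Induction for bounded measurable functions: indicators, sums and bounded pointwise limits. -/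
theorem bounded_measurable_induction {P : (X → ℂ) → Prop}
    (indicator : ∀ (c : ℂ) (s : Set X), MeasurableSet s → P (s.indicator fun _ => c))
    (add : ∀ (f g : X → ℂ) (C D : ℝ), Measurable f → Measurable g → (∀ x, ‖f x‖ ≤ C) →
      (∀ x, ‖g x‖ ≤ D) → P f → P g → P (f + g))
    (lim : ∀ (F : ℕ → X → ℂ) (f : X → ℂ) (C : ℝ), (∀ n, Measurable (F n)) →
      (∀ n x, ‖F n x‖ ≤ C) → (∀ x, Tendsto (fun n => F n x) atTop (𝓝 (f x))) →
      (∀ n, P (F n)) → P f)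
    {f : X → ℂ} (hf : Measurable f) {C : ℝ} (hC : ∀ x, ‖f x‖ ≤ C) : P f := by
  have hs : ∀ g : SimpleFunc X ℂ, P g := by
    intro g
    induction g using SimpleFunc.induction with
    | const c hs => simpa using! indicator c _ hs
    | @add g h _ hg hh =>
      obtain ⟨D, hD⟩ := g.exists_forall_norm_le
      obtain ⟨D', hD'⟩ := h.exists_forall_norm_le
      exact add g h D D' g.measurable h.measurable hD hD' hg hh
  have hm := hf.stronglyMeasurable
  rcases isEmpty_or_nonempty X with hX | ⟨⟨x₀⟩⟩
  · have : f = (0 : SimpleFunc X ℂ) := funext fun x => (hX.false x).elim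
    rw [this]; exact hs 0
  have hC0 : 0 ≤ C := (norm_nonneg _).trans (hC x₀)
  exact lim (fun n => hm.approxBounded C n) f C (fun n => SimpleFunc.measurable _)
    (fun n x => hm.norm_approxBounded_le hC0 n x)
    (fun x => hm.tendsto_approxBounded_of_norm_le (hC x)) fun n => hs _

theorem cintegral_indicator (μ : ComplexMeasure X) {s : Set X} (hs : MeasurableSet s) (c : ℂ) :
    cintegral μ (s.indicator fun _ => c) = c * μ s := by
  simp [cintegral, VectorMeasure.integral_indicator hs]

theorem cintegral_add (μ : ComplexMeasure X) {f g : X → ℂ} (hf : μ.Integrable f)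
    (hg : μ.Integrable g) : cintegral μ (f + g) = cintegral μ f + cintegral μ g :=
  VectorMeasure.integral_add hf hg

theorem tendsto_cintegral (μ : ComplexMeasure X) {F : ℕ → X → ℂ} {f : X → ℂ} {C : ℝ}
    (hF : ∀ n, Measurable (F n)) (hC : ∀ n x, ‖F n x‖ ≤ C)
    (h : ∀ x, Tendsto (fun n => F n x) atTop (𝓝 (f x))) :
    Tendsto (fun n => cintegral μ (F n)) atTop (𝓝 (cintegral μ f)) :=
  VectorMeasure.tendsto_integral_filter_of_norm_le_const
    (Eventually.of_forall fun n => (hF n).aestronglyMeasurable)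
    ⟨C, Eventually.of_forall fun n => Eventually.of_forall (hC n)⟩ (Eventually.of_forall h)

/-- The pairing in `cintegral` is only real bilinear, so complex scalars on the measure are handled
by approximation from indicators. -/
theorem cintegral_smul_measure (μ : ComplexMeasure X) (c : ℂ) {f : X → ℂ} (hf : Measurable f)
    {C : ℝ} (hC : ∀ x, ‖f x‖ ≤ C) : cintegral (c • μ) f = c * cintegral μ f := by
  refine bounded_measurable_induction (P := fun f => cintegral (c • μ) f = c * cintegral μ f)
    ?_ ?_ ?_ hf hC
  · intro d s hs
    rw [cintegral_indicator _ hs, cintegral_indicator _ hs, smul_apply, smul_eq_mul]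
    ring
  · intro f g C D hf hg hC hD h1 h2
    rw [cintegral_add _ (integrable_of_bounded _ hf hC) (integrable_of_bounded _ hg hD),
      cintegral_add _ (integrable_of_bounded _ hf hC) (integrable_of_bounded _ hg hD), h1, h2]
    ring
  · intro F f C hF hC h hP
    refine tendsto_nhds_unique (tendsto_cintegral (c • μ) hF hC h) ?_
    simp_rw [hP]
    exact (tendsto_cintegral μ hF hC h).const_mul c

theorem cintegral_const_mul (μ : ComplexMeasure X) (c : ℂ) (f : X → ℂ) :
    cintegral μ (fun x => c * f x) = c * cintegral μ f :=
  setToFun_smul _ (fun c s x => by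
    change c * x * μ s = c * (x * μ s)
    rw [mul_assoc]) c f

theorem cintegral_real_smul_measure (μ : ComplexMeasure X) (c : ℝ) (f : X → ℂ) :
    cintegral (c • μ) f = c * cintegral μ f := by
  rw [cintegral, VectorMeasure.integral_smul_vectorMeasure, Complex.real_smul, cintegral]

theorem cintegral_add_measure (μ ν : ComplexMeasure X) {f : X → ℂ} (hμ : μ.Integrable f)
    (hν : ν.Integrable f) : cintegral (μ + ν) f = cintegral μ f + cintegral ν f :=
  VectorMeasure.integral_add_vectorMeasure hμ hν

theorem cintegral_sum_measure {ι : Type*} (s : Finset ι) (μ : ι → ComplexMeasure X) {f : X → ℂ}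
    (hμ : ∀ i ∈ s, (μ i).Integrable f) :
    cintegral (∑ i ∈ s, μ i) f = ∑ i ∈ s, cintegral (μ i) f :=
  VectorMeasure.integral_finsetSum_vectorMeasure hμ

theorem cintegral_dirac [MeasurableSingletonClass X] (x : X) (c : ℂ) (f : X → ℂ) :
    cintegral (VectorMeasure.dirac x c) f = f x * c := by
  simp [cintegral]

theorem cintegral_map (μ : ComplexMeasure X) {g : X → Y} (hg : Measurable g) {f : Y → ℂ}
    (hf : Measurable f) (hfi : μ.Integrable (f ∘ g)) :
    cintegral (μ.map g) f = cintegral μ (f ∘ g) :=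
  VectorMeasure.integral_map hg hf.aestronglyMeasurable hfi

/-- Instead of Fubini, bounded-function induction in each factor reduces to rectangles, where it is
the defining property of the product. -/
theorem cintegral_prod_mul (μ : ComplexMeasure X) (ν : ComplexMeasure Y) {f : X → ℂ} {g : Y → ℂ}
    (hf : Measurable f) (hg : Measurable g) {C D : ℝ} (hC : ∀ x, ‖f x‖ ≤ C)
    (hD : ∀ y, ‖g y‖ ≤ D) :
    cintegral (μ.prod ν (ContinuousLinearMap.mul ℝ ℂ)) (fun p => f p.1 * g p.2)
      = cintegral μ f * cintegral ν g := by
  set ρ : ComplexMeasure (X × Y) := μ.prod ν (ContinuousLinearMap.mul ℝ ℂ) with hρ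
  have bound : ∀ {f : X → ℂ} {g : Y → ℂ} {C D : ℝ}, (∀ x, ‖f x‖ ≤ C) → (∀ y, ‖g y‖ ≤ D) →
      ∀ p : X × Y, ‖f p.1 * g p.2‖ ≤ C * D := fun hC hD p => by
    rw [norm_mul]
    exact mul_le_mul (hC _) (hD _) (norm_nonneg _) ((norm_nonneg _).trans (hC p.1))
  have meas : ∀ {f : X → ℂ} {g : Y → ℂ}, Measurable f → Measurable g →
      Measurable fun p : X × Y => f p.1 * g p.2 := fun hf hg =>
    (hf.comp measurable_fst).mul (hg.comp measurable_snd)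
  refine bounded_measurable_induction (P := fun f =>
    cintegral ρ (fun p => f p.1 * g p.2) = cintegral μ f * cintegral ν g) ?_ ?_ ?_ hf hC
  · intro c s hs
    have hcs : ∀ x, ‖s.indicator (fun _ => c) x‖ ≤ ‖c‖ := fun x =>
      norm_indicator_le_norm_self _ _
    have hms : Measurable (s.indicator fun _ => c) := measurable_const.indicator hs
    refine bounded_measurable_induction (P := fun g =>
      cintegral ρ (fun p => s.indicator (fun _ => c) p.1 * g p.2)
        = cintegral μ (s.indicator fun _ => c) * cintegral ν g) ?_ ?_ ?_ hg hD
    · intro d t ht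
      have : (fun p : X × Y => s.indicator (fun _ => c) p.1 * t.indicator (fun _ => d) p.2)
          = (s ×ˢ t).indicator fun _ => c * d := by
        classical
        ext p
        simp only [Set.indicator_apply, Set.mem_prod]
        split_ifs <;> simp_all
      rw [this, cintegral_indicator _ (hs.prod ht), cintegral_indicator _ hs,
        cintegral_indicator _ ht, hρ, VectorMeasure.prod_apply, ContinuousLinearMap.mul_apply']
      ring
    · intro g h D D' hg hh hD hD' h1 h2
      have : (fun p : X × Y => s.indicator (fun _ => c) p.1 * (g + h) p.2)
          = (fun p => s.indicator (fun _ => c) p.1 * g p.2)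
            + fun p => s.indicator (fun _ => c) p.1 * h p.2 := by
        ext p; simp [mul_add]
      rw [this, cintegral_add _ (integrable_of_bounded _ (meas hms hg) (bound hcs hD))
        (integrable_of_bounded _ (meas hms hh) (bound hcs hD')), h1, h2,
        cintegral_add _ (integrable_of_bounded _ hg hD) (integrable_of_bounded _ hh hD')]
      ring
    · intro F g D hF hD h hP
      refine tendsto_nhds_unique (tendsto_cintegral ρ (fun n => meas hms (hF n))
        (fun n => bound hcs (hD n)) fun p => (h p.2).const_mul _) ?_
      simp_rw [hP]
      exact (tendsto_cintegral ν hF hD h).const_mul _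
  · intro f h C D' hf hh hC hD' h1 h2
    have : (fun p : X × Y => (f + h) p.1 * g p.2)
        = (fun p => f p.1 * g p.2) + fun p => h p.1 * g p.2 := by
      ext p; simp [add_mul]
    rw [this, cintegral_add _ (integrable_of_bounded _ (meas hf hg) (bound hC hD))
      (integrable_of_bounded _ (meas hh hg) (bound hD' hD)), h1, h2,
      cintegral_add _ (integrable_of_bounded _ hf hC) (integrable_of_bounded _ hh hD')]
    ring
  · intro F f C hF hC h hP
    refine tendsto_nhds_unique (tendsto_cintegral ρ (fun n => meas (hF n) hg)
      (fun n => bound (hC n) hD) fun p => (h p.1).mul_const _) ?_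
    simp_rw [hP]
    exact (tendsto_cintegral μ hF hC h).mul_const _

/-- Integration against a complex measure that is a positive measure. -/
theorem cintegral_eq_integral (μ : ComplexMeasure X) (m : Measure X) [IsFiniteMeasure m]
    (h : ∀ s, MeasurableSet s → μ s = (m.real s : ℂ)) {f : X → ℂ} (hf : Integrable f m) :
    cintegral μ f = ∫ x, f x ∂m := by
  have hle : μ.variation ≤ m := by
    refine VectorMeasure.variation_le_of_forall_enorm_le fun s hs => ?_
    rw [h s hs, ← ofReal_norm, Complex.norm_real, Real.norm_of_nonneg measureReal_nonneg,
      ofReal_measureReal]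
  have hT : DominatedFinMeasAdditive m (μ.transpose (ContinuousLinearMap.mul ℝ ℂ)) 1 := by
    refine ⟨fun s t hs ht _ _ hd =>
      cbmApplyMeasure_union μ (ContinuousLinearMap.mul ℝ ℂ) hs ht hd, fun s hs _ => ?_⟩
    refine (norm_cbmApplyMeasure_le μ (ContinuousLinearMap.mul ℝ ℂ) s).trans ?_
    rw [h s hs, Complex.norm_real, Real.norm_of_nonneg measureReal_nonneg]
    exact mul_le_mul_of_nonneg_right (ContinuousLinearMap.opNorm_mul_le ℝ ℂ) measureReal_nonneg
  -- The left integral is built over the variation of `μ`, the right one over `m`. As the variation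
  -- is dominated by `m`, both can be computed over `m`, where the two set functions agree.
  rw [cintegral, VectorMeasure.integral_eq_setToFun, integral_eq_setToFun,
    ← setToFun_congr_measure_of_integrable 1 (by simp) (by simpa using hle) hT _ f hf]
  refine setToFun_congr_left' _ _ (fun s hs _ => ?_) f
  refine ContinuousLinearMap.ext fun z => ?_
  change z * μ s = m.real s • z
  rw [h s hs, Complex.real_smul, mul_comm]

end Integration

/-! ### Projection-valued measures and bounded functional calculus. -/

section SpectralMeasures

variable {H : Type*} [NormedAddCommGroup H] [InnerProductSpace ℂ H] [CompleteSpace H]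

namespace SpectralMeasure

variable (E : SpectralMeasure H)

theorem innerMeasure_apply (x y : H) (Δ : Set ℝ) : E.innerMeasure x y Δ = ⟪x, E Δ y⟫_ℂ := rfl

theorem inner_apply_comm (Δ : Set ℝ) (x y : H) : ⟪E Δ x, y⟫_ℂ = ⟪x, E Δ y⟫_ℂ := by
  by_cases hΔ : MeasurableSet Δ
  · exact ((E.isStarProjection' Δ hΔ).isSelfAdjoint.isSymmetric x y)
  · simp [E.not_measurable' Δ hΔ]

theorem apply_apply_self {Δ : Set ℝ} (hΔ : MeasurableSet Δ) (x : H) : E Δ (E Δ x) = E Δ x := by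
  have := (E.isStarProjection' Δ hΔ).isIdempotentElem
  exact DFunLike.congr_fun this x

theorem inner_apply_self {Δ : Set ℝ} (hΔ : MeasurableSet Δ) (x : H) :
    ⟪x, E Δ x⟫_ℂ = ((‖E Δ x‖ ^ 2 : ℝ) : ℂ) := by
  rw [← E.apply_apply_self hΔ x, ← E.inner_apply_comm, E.apply_apply_self hΔ x,
    inner_self_eq_norm_sq_to_K]
  simp

theorem norm_apply_le (Δ : Set ℝ) (x : H) : ‖E Δ x‖ ≤ ‖x‖ := by
  by_cases hΔ : MeasurableSet Δ
  · have := (E Δ).le_of_opNorm_le (IsStarProjection.norm_le _ (E.isStarProjection' Δ hΔ)) x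
    simpa using this
  · simp [E.not_measurable' Δ hΔ]

theorem apply_union {Δ Δ' : Set ℝ} (hΔ : MeasurableSet Δ) (hΔ' : MeasurableSet Δ')
    (hd : Disjoint Δ Δ') (x : H) : E (Δ ∪ Δ') x = E Δ x + E Δ' x := by
  refine ext_inner_left ℂ fun y => ?_
  rw [inner_add_right]
  exact (E.innerMeasure y x).of_union hd hΔ hΔ'

/-- With `z = E Δ' x`, additivity of the quadratic form gives `‖E Δ z‖² + ‖z‖² = ‖E (Δ ∪ Δ') z‖² ≤
‖z‖²`. -/
theorem apply_apply_of_disjoint {Δ Δ' : Set ℝ} (hΔ : MeasurableSet Δ) (hΔ' : MeasurableSet Δ')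
    (hd : Disjoint Δ Δ') (x : H) : E Δ (E Δ' x) = 0 := by
  set z := E Δ' x with hz
  have hz' : E Δ' z = z := E.apply_apply_self hΔ' x
  have h1 : ‖E (Δ ∪ Δ') z‖ ^ 2 = ‖E Δ z‖ ^ 2 + ‖E Δ' z‖ ^ 2 := by
    have h := E.inner_apply_self (hΔ.union hΔ') z
    rw [E.apply_union hΔ hΔ' hd, inner_add_right, E.inner_apply_self hΔ,
      E.inner_apply_self hΔ', ← E.apply_union hΔ hΔ' hd] at h
    exact_mod_cast h.symm
  have h2 : ‖E (Δ ∪ Δ') z‖ ^ 2 ≤ ‖z‖ ^ 2 := by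
    gcongr
    exact E.norm_apply_le _ z
  rw [h1, hz'] at h2
  have h3 : ‖E Δ z‖ ^ 2 ≤ 0 := by linarith
  simpa using le_antisymm h3 (sq_nonneg _)

theorem apply_add_apply_compl {Δ : Set ℝ} (hΔ : MeasurableSet Δ) (x : H) :
    E Δ x + E Δᶜ x = x := by
  rw [← E.apply_union hΔ hΔ.compl disjoint_compl_right, Set.union_compl_self, E.univ']
  rfl

theorem apply_apply {Δ Δ' : Set ℝ} (hΔ : MeasurableSet Δ) (hΔ' : MeasurableSet Δ') (x : H) :
    E Δ (E Δ' x) = E (Δ ∩ Δ') x := by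
  have h1 : E Δ' x = E (Δ ∩ Δ') x + E (Δᶜ ∩ Δ') x := by
    rw [← E.apply_union (hΔ.inter hΔ') (hΔ.compl.inter hΔ')
      (disjoint_compl_right.mono Set.inter_subset_left Set.inter_subset_left),
      ← Set.union_inter_distrib_right, Set.union_compl_self, Set.univ_inter]
  rw [h1, map_add, E.apply_apply_of_disjoint hΔ (hΔ.compl.inter hΔ')
    (disjoint_compl_right.mono_right Set.inter_subset_left), add_zero]
  have h2 := E.apply_add_apply_compl hΔ (E (Δ ∩ Δ') x)
  rwa [E.apply_apply_of_disjoint hΔ.compl (hΔ.inter hΔ')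
    (disjoint_compl_left.mono_right Set.inter_subset_left), add_zero] at h2

theorem normSqMeasure_apply {Δ : Set ℝ} (hΔ : MeasurableSet Δ) (x : H) :
    E.normSqMeasure x Δ = ENNReal.ofReal (‖E Δ x‖ ^ 2) := by
  rw [normSqMeasure, Measure.ofMeasurable_apply _ hΔ, E.inner_apply_self hΔ, Complex.ofReal_re]

instance (x : H) : IsFiniteMeasure (E.normSqMeasure x) :=
  ⟨by rw [E.normSqMeasure_apply .univ]; exact ENNReal.ofReal_lt_top⟩

theorem normSqMeasure_real_apply {Δ : Set ℝ} (hΔ : MeasurableSet Δ) (x : H) :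
    (E.normSqMeasure x).real Δ = ‖E Δ x‖ ^ 2 := by
  rw [measureReal_def, E.normSqMeasure_apply hΔ, ENNReal.toReal_ofReal (by positivity)]

theorem innerMeasure_self_apply {Δ : Set ℝ} (hΔ : MeasurableSet Δ) (x : H) :
    E.innerMeasure x x Δ = ((E.normSqMeasure x).real Δ : ℂ) := by
  rw [innerMeasure_apply, E.inner_apply_self hΔ, E.normSqMeasure_real_apply hΔ]

theorem innerMeasure_add_left (x x' y : H) :
    E.innerMeasure (x + x') y = E.innerMeasure x y + E.innerMeasure x' y := by
  ext Δ _
  exact inner_add_left ..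

theorem innerMeasure_add_right (x y y' : H) :
    E.innerMeasure x (y + y') = E.innerMeasure x y + E.innerMeasure x y' := by
  ext Δ _
  simp [innerMeasure_apply]

theorem innerMeasure_smul_left (c : ℂ) (x y : H) :
    E.innerMeasure (c • x) y = (starRingEnd ℂ c) • E.innerMeasure x y := by
  ext Δ _
  simp [innerMeasure_apply, mul_comm]

theorem innerMeasure_smul_right (c : ℂ) (x y : H) :
    E.innerMeasure x (c • y) = c • E.innerMeasure x y := by
  ext Δ _
  simp [innerMeasure_apply]

/-- Writing `⟨x, E Δ y⟩` as `⟨E Δ x, E Δ y⟩`, Cauchy–Schwarz bounds it by `‖E Δ x‖ ‖E Δ y‖`, hence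
by the sum of the squares. -/
theorem variation_innerMeasure_le (x y : H) :
    (E.innerMeasure x y).variation ≤ E.normSqMeasure x + E.normSqMeasure y := by
  refine VectorMeasure.variation_le_of_forall_enorm_le fun Δ hΔ => ?_
  rw [Measure.add_apply, E.normSqMeasure_apply hΔ, E.normSqMeasure_apply hΔ,
    ← ENNReal.ofReal_add (by positivity) (by positivity), ← ofReal_norm, innerMeasure_apply,
    ← E.apply_apply_self hΔ y, ← E.inner_apply_comm, E.apply_apply_self hΔ y]
  refine ENNReal.ofReal_le_ofReal ((norm_inner_le_norm _ _).trans ?_)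
  nlinarith [sq_nonneg (‖E Δ x‖ - ‖E Δ y‖), sq_nonneg ‖E Δ x‖, sq_nonneg ‖E Δ y‖]

/-- The variation bound `‖x‖² + ‖y‖²` is not homogeneous in each variable; it is applied to unit
vectors, where it equals 2, and then rescaled. The constant is not sharp, but only boundedness of
the sesquilinear form matters. -/
theorem norm_cintegral_innerMeasure_le {f : ℝ → ℂ} (hf : Measurable f) {C : ℝ}
    (hC : ∀ a, ‖f a‖ ≤ C) (x y : H) :
    ‖cintegral (E.innerMeasure x y) f‖ ≤ 2 * C * ‖x‖ * ‖y‖ := by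
  have hC0 : 0 ≤ C := (norm_nonneg _).trans (hC 0)
  have unit : ∀ x y : H, ‖x‖ = 1 → ‖y‖ = 1 → ‖cintegral (E.innerMeasure x y) f‖ ≤ 2 * C := by
    intro x y hx hy
    refine (VectorMeasure.norm_integral_le_of_norm_le_const
      (Filter.Eventually.of_forall hC)).trans ?_
    have h1 : (E.innerMeasure x y).variation.real Set.univ ≤ 2 := by
      refine (ENNReal.toReal_mono (measure_ne_top _ _)
        (E.variation_innerMeasure_le x y Set.univ)).trans_eq ?_
      rw [Measure.add_apply, ENNReal.toReal_add (measure_ne_top _ _) (measure_ne_top _ _)]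
      change (E.normSqMeasure x).real Set.univ + (E.normSqMeasure y).real Set.univ = 2
      rw [E.normSqMeasure_real_apply .univ, E.normSqMeasure_real_apply .univ, E.univ']
      simp [hx, hy]; norm_num
    have h2 := ContinuousLinearMap.opNorm_mul_le ℝ ℂ
    calc C * ‖ContinuousLinearMap.mul ℝ ℂ‖ * (E.innerMeasure x y).variation.real Set.univ
        ≤ C * 1 * 2 := by gcongr
      _ = 2 * C := by ring
  rcases eq_or_ne x 0 with rfl | hx
  · have : E.innerMeasure (0 : H) y = 0 := by ext; simp [innerMeasure_apply]
    simp [this, cintegral]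
  rcases eq_or_ne y 0 with rfl | hy
  · have : E.innerMeasure x (0 : H) = 0 := by ext; simp [innerMeasure_apply]
    simp [this, cintegral]
  have hx' : ‖x‖ ≠ 0 := norm_ne_zero_iff.2 hx
  have hy' : ‖y‖ ≠ 0 := norm_ne_zero_iff.2 hy
  have h := unit (((‖x‖⁻¹ : ℝ) : ℂ) • x) (((‖y‖⁻¹ : ℝ) : ℂ) • y)
    (by rw [norm_smul, Complex.norm_real, norm_inv, norm_norm, inv_mul_cancel₀ hx'])
    (by rw [norm_smul, Complex.norm_real, norm_inv, norm_norm, inv_mul_cancel₀ hy'])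
  rw [innerMeasure_smul_left, innerMeasure_smul_right, cintegral_smul_measure _ _ hf hC,
    cintegral_smul_measure _ _ hf hC, norm_mul, norm_mul, Complex.conj_ofReal, Complex.norm_real,
    Complex.norm_real, norm_inv, norm_inv, norm_norm, norm_norm] at h
  have h3 : 0 < ‖x‖ * ‖y‖ := by positivity
  calc _ = (‖x‖⁻¹ * (‖y‖⁻¹ * ‖cintegral (E.innerMeasure x y) f‖)) * (‖x‖ * ‖y‖) := by
        field_simp
    _ ≤ 2 * C * (‖x‖ * ‖y‖) := by gcongr
    _ = _ := by ring

/-- The operator `∫ f dE` exists for bounded measurable `f`. -/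
theorem exists_integral {f : ℝ → ℂ} (hf : Measurable f) {C : ℝ} (hC : ∀ a, ‖f a‖ ≤ C) :
    ∃ T : H →L[ℂ] H, ∀ x y : H, ⟪x, T y⟫_ℂ = cintegral (E.innerMeasure x y) f := by
  let L : H →ₗ⋆[ℂ] H →ₗ[ℂ] ℂ := LinearMap.mk₂'ₛₗ (starRingEnd ℂ) (RingHom.id ℂ)
    (fun x y => cintegral (E.innerMeasure x y) f)
    (fun x x' y => by
      rw [innerMeasure_add_left, cintegral_add_measure _ _ (integrable_of_bounded _ hf hC)
        (integrable_of_bounded _ hf hC)])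
    (fun c x y => by
      rw [innerMeasure_smul_left, cintegral_smul_measure _ _ hf hC, smul_eq_mul])
    (fun x y y' => by
      rw [innerMeasure_add_right, cintegral_add_measure _ _ (integrable_of_bounded _ hf hC)
        (integrable_of_bounded _ hf hC)])
    (fun c x y => by
      rw [innerMeasure_smul_right, cintegral_smul_measure _ _ hf hC, smul_eq_mul, RingHom.id_apply])
  let B : H →L⋆[ℂ] H →L[ℂ] ℂ :=
    L.mkContinuous₂ (2 * C) fun x y => E.norm_cintegral_innerMeasure_le hf hC x y
  -- The operator representing the form acts in the first slot of the inner product; its adjoint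
  -- moves it to the second.
  refine ⟨ContinuousLinearMap.adjoint (InnerProductSpace.continuousLinearMapOfBilin B),
    fun x y => ?_⟩
  rw [ContinuousLinearMap.adjoint_inner_right,
    InnerProductSpace.continuousLinearMapOfBilin_apply]
  rfl

end SpectralMeasure

theorem inner_boundedFunctionalCalculus (A : H →ₗ.[ℂ] H) {f : ℝ → ℂ} (hf : Measurable f) {C : ℝ}
    (hC : ∀ a, ‖f a‖ ≤ C) (x y : H) :
    ⟪x, boundedFunctionalCalculus A f y⟫_ℂ = cintegral ((spectralMeasure A).innerMeasure x y) f := by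
  have h := (spectralMeasure A).exists_integral hf hC
  rw [boundedFunctionalCalculus, dif_pos h]
  exact h.choose_spec x y

theorem norm_exp_neg_I_mul (r : ℝ) : ‖Complex.exp (-Complex.I * (r : ℂ))‖ = 1 := by
  rw [neg_mul, mul_comm, ← neg_mul, ← Complex.ofReal_neg, Complex.norm_exp_ofReal_mul_I]

theorem inner_expNegI (A : H →ₗ.[ℂ] H) (s : ℝ) (x y : H) :
    ⟪x, expNegI A s y⟫_ℂ = cintegral ((spectralMeasure A).innerMeasure x y)
      fun a => Complex.exp (-Complex.I * (s * a)) :=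
  inner_boundedFunctionalCalculus A (by fun_prop) (C := 1)
    (fun a => by rw [← Complex.ofReal_mul, norm_exp_neg_I_mul]) x y

end SpectralMeasures

/-! ### Resolvents of partially defined operators. -/

section Resolvent

variable {H : Type*} [NormedAddCommGroup H] [InnerProductSpace ℂ H]

theorem mem_eigenspace_iff {B : H →ₗ.[ℂ] H} {z : ℂ} {x : H} :
    x ∈ eigenspace B z ↔ ∃ h : x ∈ B.domain, B ⟨x, h⟩ = z • x := by
  constructor
  · rintro ⟨x, hx, rfl⟩
    refine ⟨x.2, ?_⟩
    simpa [sub_eq_zero] using! hx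
  · rintro ⟨h, hx⟩
    refine ⟨⟨x, h⟩, ?_, rfl⟩
    simpa [sub_eq_zero] using! hx

/-- `R` is the resolvent `(B - z)⁻¹`. -/
def IsResolvent (B : H →ₗ.[ℂ] H) (z : ℂ) (R : H →L[ℂ] H) : Prop :=
  (∀ y : H, ∃ h : R y ∈ B.domain, B ⟨R y, h⟩ - z • R y = y) ∧
    ∀ x : B.domain, R (B x - z • (x : H)) = x

/-- The resolvent identity: apply `R` to `(B - z) S y = y + (w - z) S y`. -/
theorem IsResolvent.sub_eq {B : H →ₗ.[ℂ] H} {z w : ℂ} {R S : H →L[ℂ] H} (hR : IsResolvent B z R)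
    (hS : IsResolvent B w S) : S - R = (w - z) • (R * S) := by
  ext y
  obtain ⟨h, hy⟩ := hS.1 y
  have h1 := hR.2 ⟨S y, h⟩
  have h2 : B ⟨S y, h⟩ - z • S y = y + (w - z) • S y := by
    rw [sub_eq_iff_eq_add] at hy
    rw [hy, sub_smul]; abel
  rw [h2, map_add, map_smul] at h1
  simp only [sub_apply, smul_apply, mul_apply_eq_comp]
  exact sub_eq_iff_eq_add'.2 h1.symm

theorem IsResolvent.injective {B : H →ₗ.[ℂ] H} {z : ℂ} {R : H →L[ℂ] H} (hR : IsResolvent B z R)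
    {y : H} (hy : R y = 0) : y = 0 := by
  obtain ⟨h, h1⟩ := hR.1 y
  have : (⟨R y, h⟩ : B.domain) = 0 := Subtype.ext hy
  rw [this, hy] at h1
  simpa using h1.symm

/-- If `S = (B - z - w⁻¹)⁻¹` existed, then `w⁻¹ (B - z) S = w⁻¹ (1 + w⁻¹ S)` would invert `w - R`.
-/
theorem IsResolvent.mem_spectrum {B : H →ₗ.[ℂ] H} {z : ℂ} {R : H →L[ℂ] H}
    (hR : IsResolvent B z R) {w : ℂ} (hw : w ∈ _root_.spectrum ℂ R) (hw0 : w ≠ 0) :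
    z + w⁻¹ ∈ spectrum B := by
  intro hmem
  obtain ⟨S, hS⟩ : ∃ S, IsResolvent B (z + w⁻¹) S := hmem
  have h1 := hR.sub_eq hS
  have h2 := hS.sub_eq hR
  simp only [add_sub_cancel_left, sub_add_cancel_left] at h1 h2
  have hR1 : R * S = w • (S - R) := by rw [h1, smul_smul, mul_inv_cancel₀ hw0, one_smul]
  have hR2 : S * R = w • (S - R) := by
    rw [← neg_sub R S, h2, smul_neg, smul_smul]
    simp [hw0]
  refine hw ?_
  have h3 : (algebraMap ℂ (H →L[ℂ] H) w - R) * (w⁻¹ • (1 + w⁻¹ • S)) = 1 := by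
    rw [Algebra.algebraMap_eq_smul_one]
    simp only [sub_mul, mul_add, smul_mul_assoc, mul_smul_comm, one_mul, mul_one, hR1]
    simp only [smul_add, smul_sub, smul_smul]
    simp [hw0]
  have h4 : (w⁻¹ • (1 + w⁻¹ • S)) * (algebraMap ℂ (H →L[ℂ] H) w - R) = 1 := by
    rw [Algebra.algebraMap_eq_smul_one]
    simp only [mul_sub, add_mul, smul_mul_assoc, mul_smul_comm, one_mul, mul_one, hR2]
    simp only [smul_add, smul_sub, smul_smul]
    simp [hw0]
  exact ⟨⟨_, _, h3, h4⟩, rfl⟩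

theorem IsResolvent.mem_eigenspace {B : H →ₗ.[ℂ] H} {z : ℂ} {R : H →L[ℂ] H}
    (hR : IsResolvent B z R) {w : ℂ} (hw : w ≠ 0) {x : H} (hx : R x = w • x) :
    x ∈ eigenspace B (z + w⁻¹) := by
  obtain ⟨h, h1⟩ := hR.1 (w⁻¹ • x)
  have h2 : R (w⁻¹ • x) = x := by rw [map_smul, hx, smul_smul, inv_mul_cancel₀ hw, one_smul]
  refine mem_eigenspace_iff.2 ⟨h2 ▸ h, ?_⟩
  simp only [h2] at h1
  rw [sub_eq_iff_eq_add] at h1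
  rw [h1, add_smul, add_comm]

open Polynomial in
theorem ker_aeval_prod_X_sub_C (R : Module.End ℂ H) (F : Finset ℂ) :
    LinearMap.ker (aeval R (∏ w ∈ F, (X - C w))) ≤ ⨆ w ∈ F, Module.End.eigenspace R w := by
  classical
  induction F using Finset.induction_on with
  | empty => simp [Module.End.one_eq_id]
  | insert a F ha ih =>
    rw [Finset.prod_insert ha, ← Polynomial.sup_ker_aeval_eq_ker_aeval_mul_of_coprime,
      Finset.iSup_insert]
    · refine sup_le_sup (le_of_eq ?_) ih
      rw [Module.End.eigenspace_def]
      simp [Algebra.algebraMap_eq_smul_one]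
    · refine IsCoprime.prod_right fun w hw => ?_
      exact Polynomial.isCoprime_X_sub_C_of_isUnit_sub
        (sub_ne_zero.2 fun h => ha (by rwa [h])).isUnit

end Resolvent

/-! ### Completeness of the eigenvectors. -/

section FiniteSpectrum

variable {H : Type*} [NormedAddCommGroup H] [InnerProductSpace ℂ H] [CompleteSpace H]

theorem inner_map_eq_of_isSelfAdjoint {B : H →ₗ.[ℂ] H} (hB : IsSelfAdjoint B) (x y : B.domain) :
    ⟪B x, (y : H)⟫_ℂ = ⟪(x : H), B y⟫_ℂ := by
  have h := LinearPMap.adjoint_isFormalAdjoint hB.dense_domain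
  rw [LinearPMap.isSelfAdjoint_def.1 hB] at h
  exact h x y

theorem IsResolvent.isSelfAdjoint {B : H →ₗ.[ℂ] H} (hB : IsSelfAdjoint B) {r : ℝ}
    {R : H →L[ℂ] H} (hR : IsResolvent B r R) : IsSelfAdjoint R := by
  rw [ContinuousLinearMap.isSelfAdjoint_iff_isSymmetric]
  intro x y
  obtain ⟨hx, h1⟩ := hR.1 x
  obtain ⟨hy, h2⟩ := hR.1 y
  have h3 := inner_map_eq_of_isSelfAdjoint hB ⟨R x, hx⟩ ⟨R y, hy⟩
  have h4 : ⟪R x, B ⟨R y, hy⟩ - (r : ℂ) • R y⟫_ℂ = ⟪B ⟨R x, hx⟩ - (r : ℂ) • R x, R y⟫_ℂ := by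
    rw [inner_sub_left, inner_sub_right, inner_smul_left, inner_smul_right, Complex.conj_ofReal, h3]
  rw [h1, h2] at h4
  exact h4

theorem eq_zero_of_mem_eigenspace {B : H →ₗ.[ℂ] H} (hB : IsSelfAdjoint B) {z : ℂ} (hz : z.im ≠ 0)
    {x : H} (hx : x ∈ eigenspace B z) : x = 0 := by
  obtain ⟨h, hx⟩ := mem_eigenspace_iff.1 hx
  have h1 := inner_map_eq_of_isSelfAdjoint hB ⟨x, h⟩ ⟨x, h⟩
  rw [hx, inner_smul_left, inner_smul_right] at h1
  by_contra h0
  have h2 := mul_right_cancel₀ (inner_self_ne_zero.2 h0) h1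
  exact hz (Complex.conj_eq_iff_im.1 h2)

open Polynomial in
-- The polynomial `X * q` vanishes on the spectrum, so `R q(R) = 0` by the continuous functional
-- calculus. Injectivity cancels `R`, and the kernel of `q(R) = 0` splits along the distinct roots.
-- The factor `X` is there because `0` could lie in the spectrum without being an eigenvalue.
theorem iSup_eigenspace_eq_top {R : H →L[ℂ] H} (hR : IsSelfAdjoint R)
    (hinj : ∀ y, R y = 0 → y = 0) {F : Finset ℂ}
    (hF : ∀ w ∈ _root_.spectrum ℂ R, w ≠ 0 → w ∈ F) :
    ⨆ w ∈ F, Module.End.eigenspace (R : H →ₗ[ℂ] H) w = ⊤ := by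
  have hn : IsStarNormal R := hR.isStarNormal
  set q : ℂ[X] := ∏ w ∈ F, (X - C w) with hq
  have h1 : aeval R (X * q) = 0 := by
    rw [← cfc_polynomial (X * q) R]
    have h2 : Set.EqOn (X * q).eval (fun _ => 0) (_root_.spectrum ℂ R) := by
      intro w hw
      rcases eq_or_ne w 0 with rfl | hw0
      · simp
      · simp [hq, eval_prod, Finset.prod_eq_zero (hF w hw hw0)]
    rw [cfc_congr h2, cfc_const_zero]
  have h3 : ∀ y, aeval (R : H →ₗ[ℂ] H) q y = 0 := by
    intro y
    refine hinj _ ?_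
    have h4 : aeval (R : H →ₗ[ℂ] H) q = (aeval R q : H →L[ℂ] H) :=
      aeval_algHom_apply ({ ContinuousLinearMap.toLinearMapRingHom with commutes' := fun _ => rfl } :
        (H →L[ℂ] H) →ₐ[ℂ] (H →ₗ[ℂ] H)) R q
    rw [map_mul, aeval_X] at h1
    rw [h4]
    exact DFunLike.congr_fun h1 y
  rw [eq_top_iff]
  refine le_trans (fun y _ => ?_) (ker_aeval_prod_X_sub_C (R : H →ₗ[ℂ] H) F)
  exact h3 y

/-- Eigenvectors of a self-adjoint operator with finite simple spectrum span the space. -/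
theorem span_eigenvectors_eq_top {B : H →ₗ.[ℂ] H} (hB : IsSelfAdjoint B)
    (hfin : (spectrum B).Finite)
    (hnondeg : ∀ b ∈ spectrum B, Module.finrank ℂ (eigenspace B b) = 1)
    {e : ℝ → H} (he : ∀ b : ℝ, (b : ℂ) ∈ spectrum B → e b ∈ eigenspace B b ∧ ‖e b‖ = 1) :
    Submodule.span ℂ (e '' {b : ℝ | (b : ℂ) ∈ spectrum B}) = ⊤ := by
  classical
  -- A real base point makes the resolvent self-adjoint; finiteness of the spectrum supplies one.
  obtain ⟨r, hr⟩ : ∃ r : ℝ, (r : ℂ) ∉ spectrum B := by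
    by_contra! h
    exact Set.infinite_univ ((hfin.preimage Complex.ofReal_injective.injOn).subset
      fun r _ => h r)
  obtain ⟨R, hR⟩ : ∃ R, IsResolvent B r R := not_not.1 hr
  have h1 := iSup_eigenspace_eq_top (hR.isSelfAdjoint hB) (fun y => hR.injective)
    (F := hfin.toFinset.image fun z => (z - r)⁻¹) (fun w hw hw0 => by
      refine Finset.mem_image.2 ⟨r + w⁻¹, hfin.mem_toFinset.2 (hR.mem_spectrum hw hw0), ?_⟩
      simp)
  rw [eq_top_iff, ← h1]
  refine iSup₂_le fun w hw x hx => ?_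
  obtain ⟨z, hz, rfl⟩ := Finset.mem_image.1 hw
  rw [hfin.mem_toFinset] at hz
  have hzr : z - r ≠ 0 := by
    intro h
    rw [sub_eq_zero] at h
    exact hr (h ▸ hz)
  have hx1 := hR.mem_eigenspace (inv_ne_zero hzr) (x := x)
    (Module.End.mem_eigenspace_iff.1 hx)
  rw [inv_inv, add_sub_cancel] at hx1
  -- The spectrum has not been shown to be real; symmetry of `B` rules out nonzero eigenvectors for
  -- non-real `z`.
  by_cases him : z.im = 0
  · obtain ⟨b, rfl⟩ : ∃ b : ℝ, (b : ℂ) = z := ⟨z.re, Complex.ext rfl (by simp [him])⟩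
    obtain ⟨he1, he2⟩ := he b hz
    have hne : (⟨e b, he1⟩ : eigenspace B b) ≠ 0 := fun h => by
      have : e b = 0 := congrArg Subtype.val h
      simp [this] at he2
    obtain ⟨c, hc⟩ := (finrank_eq_one_iff_of_nonzero' _ hne).1 (hnondeg b hz) ⟨x, hx1⟩
    have hc' : c • e b = x := congrArg Subtype.val hc
    rw [← hc']
    exact Submodule.smul_mem _ _ (Submodule.subset_span ⟨b, hz, rfl⟩)
  · rw [eq_zero_of_mem_eigenspace hB him hx1]
    exact Submodule.zero_mem _

end FiniteSpectrum

/-! ### Orthonormal eigenbases and their spectral measures. -/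

section Eigenbasis

variable {H : Type*} [NormedAddCommGroup H] [InnerProductSpace ℂ H]

theorem ofReal_norm_inner_sq (x y : H) :
    ((‖⟪x, y⟫_ℂ‖ ^ 2 : ℝ) : ℂ) = ⟪y, x⟫_ℂ * ⟪x, y⟫_ℂ := by
  rw [← inner_conj_symm y x, Complex.conj_mul']
  norm_cast

/-- `(e b)_{b ∈ S}` is an orthonormal basis of eigenvectors of `B`. -/
structure IsEigenbasis (B : H →ₗ.[ℂ] H) (S : Finset ℝ) (e : ℝ → H) : Prop where
  mem_eigenspace : ∀ b ∈ S, e b ∈ eigenspace B b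
  inner_self : ∀ b ∈ S, ⟪e b, e b⟫_ℂ = 1
  inner_eq_zero : ∀ b ∈ S, ∀ c ∈ S, b ≠ c → ⟪e b, e c⟫_ℂ = 0
  sum_eq : ∀ x : H, ∑ b ∈ S, ⟪e b, x⟫_ℂ • e b = x

variable {B : H →ₗ.[ℂ] H} {S : Finset ℝ} {e : ℝ → H}

namespace IsEigenbasis

variable (hS : IsEigenbasis B S e)
include hS

theorem inner_sum_smul {b : ℝ} (hb : b ∈ S) (c : ℝ → ℂ) : ⟪e b, ∑ d ∈ S, c d • e d⟫_ℂ = c b := by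
  rw [inner_sum, Finset.sum_eq_single b]
  · rw [inner_smul_right, hS.inner_self b hb, mul_one]
  · intro d hd hdb
    rw [inner_smul_right, hS.inner_eq_zero b hb d hd hdb.symm, mul_zero]
  · exact fun h => (h hb).elim

theorem inner_eq_sum (x y : H) : ⟪x, y⟫_ℂ = ∑ b ∈ S, ⟪x, e b⟫_ℂ * ⟪e b, y⟫_ℂ := by
  conv_lhs => rw [← hS.sum_eq y]
  rw [inner_sum]
  exact Finset.sum_congr rfl fun b _ => by rw [inner_smul_right, mul_comm]

/-- Every vector is a finite combination of eigenvectors, so `B` is everywhere defined. -/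
theorem mem_domain (x : H) : x ∈ B.domain := by
  rw [← hS.sum_eq x]
  exact Submodule.sum_mem _ fun b hb => Submodule.smul_mem _ _
    (mem_eigenspace_iff.1 (hS.mem_eigenspace b hb)).1

theorem inner_map (x : B.domain) (y : H) :
    ⟪y, B x⟫_ℂ = ∑ b ∈ S, (b : ℂ) * (⟪y, e b⟫_ℂ * ⟪e b, (x : H)⟫_ℂ) := by
  have h1 : x = ∑ b ∈ S, ⟪e b, (x : H)⟫_ℂ • (⟨e b, hS.mem_domain _⟩ : B.domain) :=
    Subtype.ext (by simpa using (hS.sum_eq (x : H)).symm)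
  have h2 : B x = ∑ b ∈ S, ⟪e b, (x : H)⟫_ℂ • (b : ℂ) • e b := by
    conv_lhs => rw [h1]
    change B.toFun _ = _
    rw [map_sum]
    refine Finset.sum_congr rfl fun b hb => ?_
    rw [map_smul]
    obtain ⟨_, h⟩ := mem_eigenspace_iff.1 (hS.mem_eigenspace b hb)
    exact congrArg _ h
  rw [h2, inner_sum]
  refine Finset.sum_congr rfl fun b _ => ?_
  rw [inner_smul_right, inner_smul_right]
  ring

variable [CompleteSpace H]

open Classical in
/-- The spectral measure `Δ ↦ ∑_{b ∈ S ∩ Δ} |b⟩⟨b|` of an orthonormal basis of eigenvectors. -/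
def spectralMeasure : SpectralMeasure H where
  toFun Δ := if MeasurableSet Δ then
    ∑ b ∈ S, if b ∈ Δ then (innerSL ℂ (e b)).smulRight (e b) else 0 else 0
  isStarProjection' Δ hΔ := by
    rw [if_pos hΔ]
    have h : ∀ x, (∑ b ∈ S, if b ∈ Δ then (innerSL ℂ (e b)).smulRight (e b) else 0 : H →L[ℂ] H) x
        = ∑ b ∈ S, (if b ∈ Δ then ⟪e b, x⟫_ℂ else 0) • e b := by
      intro x
      rw [sum_apply]
      exact Finset.sum_congr rfl fun b _ => by split_ifs <;> simp
    refine ⟨?_, ?_⟩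
    · refine ContinuousLinearMap.ext fun x => ?_
      rw [mul_apply_eq_comp, h, h]
      refine Finset.sum_congr rfl fun b hb => ?_
      rw [hS.inner_sum_smul hb]
      split_ifs <;> rfl
    · rw [ContinuousLinearMap.isSelfAdjoint_iff_isSymmetric]
      intro x y
      change ⟪(∑ b ∈ S, if b ∈ Δ then (innerSL ℂ (e b)).smulRight (e b) else 0 : H →L[ℂ] H) x, y⟫_ℂ
        = ⟪x, (∑ b ∈ S, if b ∈ Δ then (innerSL ℂ (e b)).smulRight (e b) else 0 : H →L[ℂ] H) y⟫_ℂ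
      rw [h, h, sum_inner, inner_sum]
      refine Finset.sum_congr rfl fun b _ => ?_
      rw [inner_smul_left, inner_smul_right]
      split_ifs
      · rw [inner_conj_symm, mul_comm]
      · simp
  not_measurable' Δ h := by simp [h]
  empty' := by simp
  univ' := by
    refine ContinuousLinearMap.ext fun x => ?_
    simpa using hS.sum_eq x
  iUnion' Δ hm hd x := by
    simp only [hm, if_true, MeasurableSet.iUnion hm, sum_apply]
    refine hasSum_sum fun b _ => ?_
    by_cases h : ∃ n, b ∈ Δ n
    · obtain ⟨n, hn⟩ := h
      rw [if_pos (Set.mem_iUnion.2 ⟨n, hn⟩)]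
      have h1 : (innerSL ℂ (e b)).smulRight (e b) x
          = (if b ∈ Δ n then (innerSL ℂ (e b)).smulRight (e b) else (0 : H →L[ℂ] H)) x := by
        rw [if_pos hn]
      rw [h1]
      refine hasSum_single n fun m hmn => ?_
      rw [if_neg fun h0 => Set.disjoint_left.1 (hd hmn) h0 hn]
      rfl
    · have h' : ∀ n, b ∉ Δ n := fun n hn => h ⟨n, hn⟩
      simp [h']

open Classical in
theorem spectralMeasure_apply {Δ : Set ℝ} (hΔ : MeasurableSet Δ) (x : H) :
    hS.spectralMeasure Δ x = ∑ b ∈ S, (if b ∈ Δ then ⟪e b, x⟫_ℂ else 0) • e b := by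
  change (if MeasurableSet Δ then
    ∑ b ∈ S, if b ∈ Δ then (innerSL ℂ (e b)).smulRight (e b) else 0 else 0 : H →L[ℂ] H) x = _
  rw [if_pos hΔ, sum_apply]
  exact Finset.sum_congr rfl fun b _ => by split_ifs <;> simp

theorem innerMeasure_eq_sum (x y : H) : hS.spectralMeasure.innerMeasure x y
    = ∑ b ∈ S, VectorMeasure.dirac b (⟪x, e b⟫_ℂ * ⟪e b, y⟫_ℂ) := by
  classical
  ext Δ hΔ
  rw [SpectralMeasure.innerMeasure_apply, hS.spectralMeasure_apply hΔ, inner_sum,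
    sum_apply]
  refine Finset.sum_congr rfl fun b _ => ?_
  rw [inner_smul_right]
  by_cases hb : b ∈ Δ
  · rw [if_pos hb, VectorMeasure.dirac_apply_of_mem hΔ hb, mul_comm]
  · rw [if_neg hb, VectorMeasure.dirac_apply_of_notMem hb, zero_mul]

theorem normSqMeasure_eq_sum (x : H) : hS.spectralMeasure.normSqMeasure x
    = ∑ b ∈ S, ENNReal.ofReal (‖⟪e b, x⟫_ℂ‖ ^ 2) • Measure.dirac b := by
  classical
  ext Δ hΔ
  have h : (((hS.spectralMeasure.normSqMeasure x).real Δ : ℝ) : ℂ)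
      = ((∑ b ∈ S, if b ∈ Δ then ‖⟪e b, x⟫_ℂ‖ ^ 2 else 0 : ℝ) : ℂ) := by
    rw [← SpectralMeasure.innerMeasure_self_apply _ hΔ, SpectralMeasure.innerMeasure_apply,
      hS.spectralMeasure_apply hΔ, inner_sum, Complex.ofReal_sum]
    refine Finset.sum_congr rfl fun b _ => ?_
    rw [inner_smul_right]
    split_ifs
    · rw [← inner_conj_symm x (e b), Complex.mul_conj']; simp
    · simp
  rw [← ofReal_measureReal, Complex.ofReal_injective h, Measure.finsetSum_apply,
    ENNReal.ofReal_sum_of_nonneg fun b _ => by split_ifs <;> positivity]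
  refine Finset.sum_congr rfl fun b _ => ?_
  by_cases hb : b ∈ Δ <;> simp [hb, hΔ]

theorem isSpectralMeasureOf : IsSpectralMeasureOf hS.spectralMeasure B := by
  refine ⟨fun x => iff_of_true (hS.mem_domain x) ?_, fun x y => ?_⟩
  · rw [hS.normSqMeasure_eq_sum, lintegral_finsetSum_measure]
    refine ENNReal.sum_lt_top.2 fun b _ => ?_
    rw [lintegral_smul_measure, lintegral_dirac]
    exact ENNReal.mul_lt_top ENNReal.ofReal_lt_top ENNReal.ofReal_lt_top
  · rw [hS.inner_map, hS.innerMeasure_eq_sum, cintegral_sum_measure]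
    · exact Finset.sum_congr rfl fun b _ => (cintegral_dirac b _ _).symm
    · intro b _
      rw [VectorMeasure.Integrable, VectorMeasure.variation_dirac]
      exact (integrable_dirac (by simp)).smul_measure enorm_ne_top

end IsEigenbasis

/-! ### Uniqueness of the spectral measure of `B`. -/

section Uniqueness

variable [CompleteSpace H] {E : SpectralMeasure H}

/-- The part of an eigenvector in a set on one side of the eigenvalue vanishes. -/
theorem IsSpectralMeasureOf.apply_eigenvector_eq_zero (hE : IsSpectralMeasureOf E B) {b : ℝ} {x : H}
    (hx : x ∈ eigenspace B b) {Δ : Set ℝ} (hΔ : MeasurableSet Δ)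
    (hb : Δ ⊆ Set.Ioi b ∨ Δ ⊆ Set.Iio b) : E Δ x = 0 := by
  obtain ⟨hxd, hBx⟩ := mem_eigenspace_iff.1 hx
  set y := E Δ x with hy
  set m := E.normSqMeasure y with hm
  -- Because `y = E Δ x`, the complex measure `⟨y, E(·) x⟩` is the positive measure `m`, so sign
  -- arguments become available.
  have hmeas : ∀ Γ, MeasurableSet Γ → E.innerMeasure y x Γ = (m.real Γ : ℂ) := by
    intro Γ hΓ
    rw [← E.innerMeasure_self_apply hΓ, E.innerMeasure_apply, E.innerMeasure_apply, hy,
      E.apply_apply hΓ hΔ, E.inner_apply_comm, E.inner_apply_comm, E.apply_apply hΔ hΓ,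
      E.apply_apply hΔ (hΓ.inter hΔ), Set.inter_comm Γ Δ, ← Set.inter_assoc, Set.inter_self]
  have hle : m ≤ E.normSqMeasure x := by
    refine Measure.le_iff.2 fun Γ hΓ => ?_
    rw [E.normSqMeasure_apply hΓ, E.normSqMeasure_apply hΓ, hy, E.apply_apply hΓ hΔ,
      Set.inter_comm, ← E.apply_apply hΔ hΓ]
    gcongr
    exact E.norm_apply_le _ _
  -- Membership of `x` in the domain bounds the second moment, and `m` is finite.
  have hint : Integrable (fun a : ℝ => a) m := by
    have h2 : MemLp (fun a : ℝ => a) 2 m := by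
      rw [memLp_two_iff_integrable_sq (by fun_prop)]
      refine ⟨by fun_prop, ?_⟩
      rw [hasFiniteIntegral_iff_ofReal (Filter.Eventually.of_forall fun a => sq_nonneg a)]
      exact (lintegral_mono' hle le_rfl).trans_lt ((hE.1 x).1 hxd)
    exact h2.integrable (by norm_num)
  have h1 : ⟪y, B ⟨x, hxd⟩⟫_ℂ = cintegral (E.innerMeasure y x) fun a => (a : ℂ) := hE.2 ⟨x, hxd⟩ y
  have hintc : Integrable (fun a : ℝ => (a : ℂ)) m := hint.ofReal
  rw [hBx, cintegral_eq_integral _ m hmeas hintc, integral_complex_ofReal, inner_smul_right] at h1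
  have h3 : ⟪y, x⟫_ℂ = (m.real Set.univ : ℂ) := by
    rw [← hmeas _ .univ, E.innerMeasure_apply, E.univ']
    rfl
  rw [h3] at h1
  -- This is the eigenvalue equation tested against `y`. Since `a - b` has constant strict sign on
  -- `Δ`, which carries `m`, its vanishing integral forces `m = 0`.
  have h4 : ∫ a, (a - b) ∂m = 0 := by
    rw [integral_sub hint (integrable_const b), integral_const, smul_eq_mul]
    have : b * m.real Set.univ = ∫ a, a ∂m := by exact_mod_cast h1
    linarith
  have hae : ∀ᵐ a ∂m, a ∈ Δ := by
    rw [ae_iff]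
    change m Δᶜ = 0
    rw [E.normSqMeasure_apply hΔ.compl, hy, E.apply_apply hΔ.compl hΔ, Set.compl_inter_self,
      E.empty']
    simp
  have hi : Integrable (fun a : ℝ => a - b) m := hint.sub (integrable_const b)
  have h5 : (fun a : ℝ => a - b) =ᵐ[m] 0 := by
    rcases hb with hb | hb
    · exact (integral_eq_zero_iff_of_nonneg_ae
        (hae.mono fun a ha => sub_nonneg.2 (le_of_lt (hb ha))) hi).1 h4
    · have h6 : ∫ a, -(a - b) ∂m = 0 := by rw [integral_neg, h4, neg_zero]
      have h7 := (integral_eq_zero_iff_of_nonneg_ae (f := fun a : ℝ => -(a - b))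
        (hae.mono fun a ha => neg_nonneg.2 (sub_nonpos.2 (le_of_lt (hb ha)))) hi.neg).1 h6
      exact h7.mono fun a ha => neg_eq_zero.1 ha
  have h6 : m = 0 := by
    rw [← ae_eq_bot, ← Filter.eventually_false_iff_eq_bot]
    filter_upwards [hae, h5] with a ha hab
    have hab : a = b := sub_eq_zero.1 hab
    rcases hb with hb | hb
    · exact (ne_of_gt (hb ha)) hab
    · exact (ne_of_lt (hb ha)) hab
  have h7 := E.normSqMeasure_real_apply .univ y
  rw [← hm, h6, E.univ'] at h7
  simpa using h7.symm

open Classical in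
theorem IsSpectralMeasureOf.apply_eigenvector (hE : IsSpectralMeasureOf E B) {b : ℝ} {x : H}
    (hx : x ∈ eigenspace B b) {Δ : Set ℝ} (hΔ : MeasurableSet Δ) :
    E Δ x = if b ∈ Δ then x else 0 := by
  have h0 : ∀ Γ, MeasurableSet Γ → b ∉ Γ → E Γ x = 0 := by
    intro Γ hΓ hb
    have h : Γ = Γ ∩ Set.Ioi b ∪ Γ ∩ Set.Iio b := by
      ext a
      rcases lt_trichotomy a b with h | h | h
      · simp [h, h.le]
      · simp [h, hb]
      · simp [h, h.le]
    rw [h, E.apply_union (hΓ.inter measurableSet_Ioi) (hΓ.inter measurableSet_Iio),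
      hE.apply_eigenvector_eq_zero hx (hΓ.inter measurableSet_Ioi) (.inl Set.inter_subset_right),
      hE.apply_eigenvector_eq_zero hx (hΓ.inter measurableSet_Iio) (.inr Set.inter_subset_right),
      add_zero]
    refine Set.disjoint_left.2 fun a h1 h2 => ?_
    exact lt_asymm (Set.mem_Ioi.1 h1.2) (Set.mem_Iio.1 h2.2)
  split_ifs with hb
  · have := E.apply_add_apply_compl hΔ x
    rwa [h0 _ hΔ.compl (fun h => h hb), add_zero] at this
  · exact h0 Δ hΔ hb

/-- The explicit measure shows that the choice defining `E_B` is not vacuous; any valid choice is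
then determined by its action on the eigenvectors, which span. -/
theorem IsEigenbasis.eq_spectralMeasure (hS : IsEigenbasis B S e) :
    QJP.spectralMeasure B = hS.spectralMeasure := by
  classical
  have hE : IsSpectralMeasureOf (QJP.spectralMeasure B) B :=
    Classical.epsilon_spec (p := fun E => IsSpectralMeasureOf E B) ⟨_, hS.isSpectralMeasureOf⟩
  have h : (QJP.spectralMeasure B).toFun = hS.spectralMeasure.toFun := by
    funext Δ
    by_cases hΔ : MeasurableSet Δ
    · refine ContinuousLinearMap.ext fun x => ?_
      rw [hS.spectralMeasure_apply hΔ]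
      conv_lhs => rw [← hS.sum_eq x]
      rw [map_sum]
      refine Finset.sum_congr rfl fun b hb => ?_
      rw [map_smul, hE.apply_eigenvector (hS.mem_eigenspace b hb) hΔ]
      split_ifs <;> simp
    · rw [SpectralMeasure.not_measurable' _ _ hΔ, SpectralMeasure.not_measurable' _ _ hΔ]
  cases h1 : QJP.spectralMeasure B
  cases h2 : hS.spectralMeasure
  rw [h1, h2] at h
  congr

/-- A self-adjoint operator with finite simple spectrum has an orthonormal basis of
eigenvectors. -/
theorem isEigenbasis_of_isSelfAdjoint (hB : IsSelfAdjoint B) (hfin : (spectrum B).Finite)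
    (hnondeg : ∀ b ∈ spectrum B, Module.finrank ℂ (eigenspace B b) = 1)
    (he : ∀ b : ℝ, (b : ℂ) ∈ spectrum B → e b ∈ eigenspace B b ∧ ‖e b‖ = 1)
    (hS : ∀ b : ℝ, b ∈ S ↔ (b : ℂ) ∈ spectrum B) : IsEigenbasis B S e := by
  have h1 : ∀ b ∈ S, ⟪e b, e b⟫_ℂ = 1 := fun b hb => by
    rw [inner_self_eq_norm_sq_to_K, (he b ((hS b).1 hb)).2]; simp
  have h2 : ∀ b ∈ S, ∀ c ∈ S, b ≠ c → ⟪e b, e c⟫_ℂ = 0 := by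
    intro b hb c hc hbc
    obtain ⟨hbd, hb'⟩ := mem_eigenspace_iff.1 (he b ((hS b).1 hb)).1
    obtain ⟨hcd, hc'⟩ := mem_eigenspace_iff.1 (he c ((hS c).1 hc)).1
    have h := inner_map_eq_of_isSelfAdjoint hB ⟨e b, hbd⟩ ⟨e c, hcd⟩
    rw [hb', hc', inner_smul_left, inner_smul_right, Complex.conj_ofReal] at h
    by_contra h0
    exact hbc (Complex.ofReal_injective (mul_right_cancel₀ h0 h))
  refine ⟨fun b hb => (he b ((hS b).1 hb)).1, h1, h2, fun x => ?_⟩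
  have hx : x ∈ Submodule.span ℂ (e '' {b : ℝ | (b : ℂ) ∈ spectrum B}) := by
    rw [span_eigenvectors_eq_top hB hfin hnondeg he]; trivial
  induction hx using Submodule.span_induction with
  | mem x hx =>
    obtain ⟨c, hc, rfl⟩ := hx
    have hc := (hS c).2 hc
    rw [Finset.sum_eq_single c (fun b hb hbc => by rw [h2 b hb c hc hbc, zero_smul])
      (fun h => (h hc).elim), h1 c hc, one_smul]
  | zero => simp
  | add x y _ _ hx hy =>
    simp only [inner_add_right, add_smul, Finset.sum_add_distrib, hx, hy]
  | smul c x _ hx =>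
    simp only [inner_smul_right, mul_smul, ← Finset.smul_sum, hx]

end Uniqueness

end Eigenbasis

/-! ### The joint quasi-probability measure and its Fourier transform. -/

section JointDistribution

variable {H : Type*} [NormedAddCommGroup H] [InnerProductSpace ℂ H] [CompleteSpace H]

theorem condMeasure_apply (A : H →ₗ.[ℂ] H) (φ v : H) (Δ : Set ℝ) :
    condMeasure A φ v Δ = (⟪v, φ⟫_ℂ)⁻¹ * ⟪v, spectralMeasure A Δ φ⟫_ℂ := by
  rw [condMeasure, smul_apply, smul_eq_mul, SpectralMeasure.innerMeasure_apply]

/-- Self-adjointness of the projections lets conjugation swap the two slots, which places `E_A` to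
the left of `|b⟩`. -/
theorem conjMeasure_condMeasure (A : H →ₗ.[ℂ] H) (φ v : H) :
    conjMeasure (condMeasure A φ v) = (⟪φ, v⟫_ℂ)⁻¹ • (spectralMeasure A).innerMeasure φ v := by
  ext Δ _
  rw [smul_apply, smul_eq_mul, SpectralMeasure.innerMeasure_apply]
  change (starRingEnd ℂ) (condMeasure A φ v Δ) = _
  rw [condMeasure_apply, map_mul, map_inv₀, inner_conj_symm, inner_conj_symm,
    SpectralMeasure.inner_apply_comm]

theorem condMeasure_univ (A : H →ₗ.[ℂ] H) {φ v : H} (h : ⟪v, φ⟫_ℂ ≠ 0) :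
    condMeasure A φ v Set.univ = 1 := by
  rw [condMeasure_apply, SpectralMeasure.univ']
  exact inv_mul_cancel₀ h

theorem isQuasiProbability_condProduct (A : H →ₗ.[ℂ] H) {φ v : H} (h : ⟪v, φ⟫_ℂ ≠ 0) :
    IsQuasiProbability (condProduct A φ v) := by
  rw [IsQuasiProbability, condProduct,
    VectorMeasure.map_apply _ (MeasurableEquiv.measurable _) .univ, Set.preimage_univ,
    ← Set.univ_prod_univ, VectorMeasure.prod_apply, condMeasure_univ A h]
  change (starRingEnd ℂ) (condMeasure A φ v Set.univ) * 1 = 1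
  rw [condMeasure_univ A h]
  simp

theorem cintegral_condProduct_exp (A : H →ₗ.[ℂ] H) (φ v : H) (s₁ s₂ : ℝ) :
    cintegral (condProduct A φ v)
        (fun a => Complex.exp (-Complex.I * ((s₁ * a.re + s₂ * a.im : ℝ) : ℂ)))
      = ((⟪φ, v⟫_ℂ)⁻¹ * ⟪φ, expNegI A s₁ v⟫_ℂ) * ((⟪v, φ⟫_ℂ)⁻¹ * ⟪v, expNegI A s₂ φ⟫_ℂ) := by
  have hb : ∀ s a : ℝ, ‖Complex.exp (-Complex.I * (s * a))‖ ≤ 1 := fun s a => by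
    rw [← Complex.ofReal_mul, norm_exp_neg_I_mul]
  have hm : ∀ s : ℝ, Measurable fun a : ℝ => Complex.exp (-Complex.I * (s * a)) := fun s => by
    fun_prop
  rw [condProduct, cintegral_map _ (MeasurableEquiv.measurable _) (by fun_prop)]
  · have : (fun a : ℂ => Complex.exp (-Complex.I * ((s₁ * a.re + s₂ * a.im : ℝ) : ℂ)))
        ∘ Complex.measurableEquivRealProd.symm = fun p : ℝ × ℝ =>
          Complex.exp (-Complex.I * (s₁ * p.1)) * Complex.exp (-Complex.I * (s₂ * p.2)) := by
      funext p
      change Complex.exp (-Complex.I * ((s₁ * p.1 + s₂ * p.2 : ℝ) : ℂ)) = _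
      rw [← Complex.exp_add]
      push_cast
      ring_nf
    rw [this, cintegral_prod_mul _ _ (hm s₁) (hm s₂) (hb s₁) (hb s₂), conjMeasure_condMeasure,
      cintegral_smul_measure _ _ (hm s₁) (hb s₁), condMeasure,
      cintegral_smul_measure _ _ (hm s₂) (hb s₂), inner_expNegI, inner_expNegI]
  · refine integrable_of_bounded _ (Measurable.comp (by fun_prop) (MeasurableEquiv.measurable _))
      (C := 1) fun p => ?_
    exact (norm_exp_neg_I_mul _).le

variable {A B : H →ₗ.[ℂ] H} {S : Finset ℝ} {e : ℝ → H} {φ : H}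

theorem IsEigenbasis.bornMeasure_eq_sum (hS : IsEigenbasis B S e) : bornMeasure B φ
    = ∑ b ∈ S, ENNReal.ofReal (‖⟪e b, φ⟫_ℂ‖ ^ 2 / ‖φ‖ ^ 2) • Measure.dirac b := by
  rw [bornMeasure, hS.eq_spectralMeasure, hS.normSqMeasure_eq_sum, Finset.smul_sum]
  refine Finset.sum_congr rfl fun b _ => ?_
  rw [smul_smul, ← ENNReal.ofReal_mul (by positivity), div_eq_inv_mul]

theorem IsEigenbasis.integral_bornMeasure (hS : IsEigenbasis B S e) (f : ℝ → ℂ) :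
    ∫ b, f b ∂(bornMeasure B φ) = ∑ b ∈ S, ((‖⟪e b, φ⟫_ℂ‖ ^ 2 / ‖φ‖ ^ 2 : ℝ) : ℂ) * f b := by
  rw [hS.bornMeasure_eq_sum, integral_finsetSum_measure]
  · refine Finset.sum_congr rfl fun b _ => ?_
    rw [integral_smul_measure, integral_dirac, ENNReal.toReal_ofReal (by positivity),
      Complex.real_smul]
  · intro b _
    exact (integrable_dirac (by simp)).smul_measure ENNReal.ofReal_ne_top

theorem IsEigenbasis.inner_expNegI_right (hS : IsEigenbasis B S e) {b : ℝ} (hb : b ∈ S) (t : ℝ)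
    (x : H) : ⟪e b, expNegI B t x⟫_ℂ = Complex.exp (-Complex.I * (t * b)) * ⟪e b, x⟫_ℂ := by
  rw [inner_expNegI, hS.eq_spectralMeasure, hS.innerMeasure_eq_sum, cintegral_sum_measure,
    Finset.sum_eq_single b]
  · rw [cintegral_dirac, hS.inner_self b hb, one_mul]
  · intro d hd hdb
    rw [hS.inner_eq_zero b hb d hd hdb.symm, zero_mul, cintegral_dirac, mul_zero]
  · exact fun h => (h hb).elim
  · intro d _
    exact integrable_of_bounded _ (by fun_prop) (C := 1)
      fun a => by rw [← Complex.ofReal_mul, norm_exp_neg_I_mul]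

/-- The quasi-probability measure `∑_b μ_B({b}) (ν_b* ⊗ ν_b) ⊗ δ_b`. -/
def jointMeasure (A : H →ₗ.[ℂ] H) (S : Finset ℝ) (e : ℝ → H) (φ : H) : ComplexMeasure (ℂ × ℝ) :=
  ∑ b ∈ S, (‖⟪e b, φ⟫_ℂ‖ ^ 2 / ‖φ‖ ^ 2 : ℝ) • (condProduct A φ (e b)).map fun a => (a, b)

theorem integrable_jointMeasure {f : ℂ × ℝ → ℂ} (hf : Measurable f)
    (h : ∀ b ∈ S, (condProduct A φ (e b)).Integrable fun a => f (a, b)) :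
    (jointMeasure A S e φ).Integrable f :=
  VectorMeasure.Integrable.finsetSum_vectorMeasure fun b hb =>
    VectorMeasure.Integrable.smul_vectorMeasure
      (VectorMeasure.Integrable.map hf.aestronglyMeasurable (h b hb)) _

theorem cintegral_jointMeasure {f : ℂ × ℝ → ℂ} (hf : Measurable f)
    (h : ∀ b ∈ S, (condProduct A φ (e b)).Integrable fun a => f (a, b)) :
    cintegral (jointMeasure A S e φ) f
      = ∑ b ∈ S, ((‖⟪e b, φ⟫_ℂ‖ ^ 2 / ‖φ‖ ^ 2 : ℝ) : ℂ)
          * cintegral (condProduct A φ (e b)) fun a => f (a, b) := by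
  rw [jointMeasure, cintegral_sum_measure]
  · refine Finset.sum_congr rfl fun b hb => ?_
    rw [cintegral_real_smul_measure, cintegral_map _ (by fun_prop) hf (h b hb)]
    rfl
  · exact fun b hb => VectorMeasure.Integrable.smul_vectorMeasure
      (VectorMeasure.Integrable.map hf.aestronglyMeasurable (h b hb)) _

theorem isQuasiProbability_jointMeasure (hS : IsEigenbasis B S e) (hφ : φ ≠ 0)
    (hov : ∀ b ∈ S, ⟪e b, φ⟫_ℂ ≠ 0) : IsQuasiProbability (jointMeasure A S e φ) := by
  have hφ' : ((‖φ‖ ^ 2 : ℝ) : ℂ) ≠ 0 := by simpa using hφ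
  have h1 : jointMeasure A S e φ Set.univ
      = ∑ b ∈ S, ((‖⟪e b, φ⟫_ℂ‖ ^ 2 / ‖φ‖ ^ 2 : ℝ) : ℂ) := by
    rw [jointMeasure, sum_apply]
    refine Finset.sum_congr rfl fun b hb => ?_
    rw [smul_apply, VectorMeasure.map_apply _ (by fun_prop) .univ, Set.preimage_univ,
      isQuasiProbability_condProduct A (hov b hb), Complex.real_smul, mul_one]
  rw [IsQuasiProbability, h1]
  simp_rw [Complex.ofReal_div, ofReal_norm_inner_sq]
  rw [← Finset.sum_div, ← hS.inner_eq_sum, inner_self_eq_norm_sq_to_K]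
  rw [div_eq_one_iff_eq hφ']
  simp

theorem isKernelProduct_jointMeasure (hS : IsEigenbasis B S e) (hφ : φ ≠ 0)
    (hmem : ∀ b ∈ S, (b : ℂ) ∈ spectrum B) (hov : ∀ b ∈ S, ⟪e b, φ⟫_ℂ ≠ 0) :
    IsKernelProduct (condKernel A B e φ) (bornMeasure B φ) (jointMeasure A S e φ) := by
  intro f hf hfin
  have hK : ∀ b ∈ S, condKernel A B e φ b = condProduct A φ (e b) := fun b hb =>
    if_pos (hmem b hb)
  have hi : ∀ b ∈ S, (condProduct A φ (e b)).Integrable fun a => f (a, b) := by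
    intro b hb
    refine ⟨Measurable.aestronglyMeasurable (by fun_prop), ?_⟩
    rw [hS.bornMeasure_eq_sum, lintegral_finsetSum_measure] at hfin
    have h1 := ENNReal.sum_lt_top.1 hfin b hb
    rw [lintegral_smul_measure, lintegral_dirac, hK b hb, smul_eq_mul] at h1
    -- Each atom of the Born measure has positive weight, so finiteness of the weighted sum gives
    -- integrability for each `b`.
    have h2 : 0 < ‖⟪e b, φ⟫_ℂ‖ := norm_pos_iff.2 (hov b hb)
    have h3 : 0 < ‖φ‖ := norm_pos_iff.2 hφ
    exact ENNReal.lt_top_of_mul_ne_top_right h1.ne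
      (ENNReal.ofReal_pos.2 (by positivity)).ne'
  refine ⟨integrable_jointMeasure hf hi, ?_⟩
  rw [cintegral_jointMeasure hf hi, hS.integral_bornMeasure]
  exact Finset.sum_congr rfl fun b hb => by rw [hK b hb]

/-- Integrals of exponentials against the joint measure. -/
theorem cintegral_jointMeasure_exp (hS : IsEigenbasis B S e) (hov : ∀ b ∈ S, ⟪e b, φ⟫_ℂ ≠ 0)
    (s₁ s₂ t : ℝ) :
    cintegral (jointMeasure A S e φ) (fun p => Complex.exp
        (-Complex.I * ((s₁ * p.1.re + s₂ * p.1.im + t * p.2 : ℝ) : ℂ)))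
      = ⟪φ, expNegI A s₁ (expNegI B t (expNegI A s₂ φ))⟫_ℂ / ((‖φ‖ ^ 2 : ℝ) : ℂ) := by
  rw [cintegral_jointMeasure (by fun_prop) fun b _ => integrable_of_bounded _ (by fun_prop)
    (C := 1) fun a => (norm_exp_neg_I_mul _).le]
  -- Inserts the resolution of the identity `∑_b |b⟩⟨b|` directly after `e^{-is₁A}`.
  rw [← hS.sum_eq (expNegI B t (expNegI A s₂ φ)), map_sum, inner_sum, Finset.sum_div]
  refine Finset.sum_congr rfl fun b hb => ?_
  have h1 : (fun a : ℂ => Complex.exp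
        (-Complex.I * ((s₁ * a.re + s₂ * a.im + t * b : ℝ) : ℂ)))
      = fun a => Complex.exp (-Complex.I * (t * b))
        * Complex.exp (-Complex.I * ((s₁ * a.re + s₂ * a.im : ℝ) : ℂ)) := by
    funext a
    rw [← Complex.exp_add]
    push_cast
    ring_nf
  rw [h1, cintegral_const_mul, cintegral_condProduct_exp, map_smul, inner_smul_right,
    hS.inner_expNegI_right hb, Complex.ofReal_div, ofReal_norm_inner_sq]
  have h2 := hov b hb
  have h3 : ⟪φ, e b⟫_ℂ ≠ 0 := fun h => h2 (inner_eq_zero_symm.1 h)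
  -- The weight `⟨φ, b⟩⟨b, φ⟩` cancels the normalisations of `ν_b*` and `ν_b`.
  field_simp

theorem measurable_paramMapProd (α : ℂ) : Measurable (paramMapProd α) := by
  refine Measurable.prodMk ?_ measurable_snd
  refine Complex.measurableEquivRealProd.symm.measurable.comp (Measurable.prodMk ?_ ?_) <;> fun_prop

/-- The transpose of `T_α` sends `s` to the pair of frequencies in the hashed operator. -/
theorem dot_paramMap (α s a : ℂ) :
    dot s (paramMap α a) = dot s ((1 - α) / 2) * a.re + dot s ((1 + α) / 2) * a.im := by
  simp only [dot, paramMap, Complex.div_ofNat_re, Complex.div_ofNat_im, Complex.sub_re,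
    Complex.sub_im, Complex.add_re, Complex.add_im, Complex.one_re, Complex.one_im]
  ring

theorem represents_jointMeasure (hS : IsEigenbasis B S e) (hφ : φ ≠ 0)
    (hov : ∀ b ∈ S, ⟪e b, φ⟫_ℂ ≠ 0) :
    Represents (jointMeasure A S e φ) (auxDistribution A B φ) :=
  ⟨isQuasiProbability_jointMeasure hS hφ hov, fun s t =>
    cintegral_jointMeasure_exp hS hov s.re s.im t⟩

theorem represents_map_jointMeasure (hS : IsEigenbasis B S e) (hφ : φ ≠ 0)
    (hov : ∀ b ∈ S, ⟪e b, φ⟫_ℂ ≠ 0) (α : ℂ) :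
    Represents ((jointMeasure A S e φ).map (paramMapProd α)) (convolutiveDistribution A B φ α) := by
  have hT := measurable_paramMapProd α
  refine ⟨?_, fun s t => ?_⟩
  · rw [IsQuasiProbability, VectorMeasure.map_apply _ hT .univ, Set.preimage_univ]
    exact isQuasiProbability_jointMeasure hS hφ hov
  · have hm : Measurable fun p : ℂ × ℝ =>
        Complex.exp (-Complex.I * ((dot s p.1 + t * p.2 : ℝ) : ℂ)) := by
      unfold dot
      fun_prop
    rw [fourier, cintegral_map _ hT hm (integrable_of_bounded _ (hm.comp hT) (C := 1)
      fun p => (norm_exp_neg_I_mul _).le)]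
    have h := cintegral_jointMeasure_exp (A := A) hS hov (dot s ((1 - α) / 2))
      (dot s ((1 + α) / 2)) t
    simp_rw [← dot_paramMap] at h
    exact h

theorem isQuasiProbabilityKernel_condKernel (hmem : ∀ b : ℝ, b ∈ S ↔ (b : ℂ) ∈ spectrum B)
    (hov : ∀ b ∈ S, ⟪e b, φ⟫_ℂ ≠ 0) : IsQuasiProbabilityKernel (condKernel A B e φ) := by
  refine ⟨fun Δ _ => ?_, fun b => ?_⟩
  -- The kernel differs from a constant only on the finite spectrum.
  · refine (measurable_const (a := (VectorMeasure.dirac 0 1 : ComplexMeasure ℂ) Δ)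
      ).measurable_of_countable_ne (S.finite_toSet.countable.mono fun b hb => ?_)
    by_contra h
    exact hb (by rw [condKernel, if_neg fun h' => h ((hmem b).2 h')])
  · rw [condKernel]
    split_ifs with h
    · exact isQuasiProbability_condProduct A (hov b ((hmem b).2 h))
    · exact VectorMeasure.dirac_apply_of_mem .univ trivial

/-- Both sides are sums over the `b` in `Δ`; the weight `|⟨b, φ⟩|²` times `ν_b(ΔA)` is `⟨φ, b⟩⟨b,
E_A(ΔA) φ⟩`. -/
theorem inner_spectralMeasure_eq_setIntegral (hS : IsEigenbasis B S e)
    (hov : ∀ b ∈ S, ⟪e b, φ⟫_ℂ ≠ 0) {Δ : Set ℝ} (hΔ : MeasurableSet Δ) (ΔA : Set ℝ) :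
    ⟪φ, spectralMeasure B Δ (spectralMeasure A ΔA φ)⟫_ℂ / ((‖φ‖ ^ 2 : ℝ) : ℂ)
      = ∫ b in Δ, condMeasure A φ (e b) ΔA ∂(bornMeasure B φ) := by
  classical
  rw [← integral_indicator hΔ, hS.integral_bornMeasure, hS.eq_spectralMeasure,
    hS.spectralMeasure_apply hΔ, inner_sum, Finset.sum_div]
  refine Finset.sum_congr rfl fun b hb => ?_
  rw [inner_smul_right, Set.indicator_apply]
  split_ifs
  · rw [condMeasure_apply, Complex.ofReal_div, ofReal_norm_inner_sq]
    have h2 := hov b hb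
    field_simp
  · simp

end JointDistribution

end QJP

end


theorem mainTheorem5 {H : Type*} [NormedAddCommGroup H] [InnerProductSpace ℂ H]
    [CompleteSpace H] (A B : H →ₗ.[ℂ] H) (hA : IsSelfAdjoint A) (hB : IsSelfAdjoint B)
    (hfin : (QJP.spectrum B).Finite)
    (hnondeg : ∀ b ∈ QJP.spectrum B, Module.finrank ℂ (QJP.eigenspace B b) = 1)
    (e : ℝ → H)
    (he : ∀ b : ℝ, (b : ℂ) ∈ QJP.spectrum B → e b ∈ QJP.eigenspace B b ∧ ‖e b‖ = 1)
    (φ : H) (hφ : φ ≠ 0)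
    (hov : ∀ b : ℝ, (b : ℂ) ∈ QJP.spectrum B → ⟪e b, φ⟫_ℂ ≠ 0) :
    (∀ Δ ΔA : Set ℝ, MeasurableSet Δ → MeasurableSet ΔA →
      ⟪φ, QJP.spectralMeasure B Δ (QJP.spectralMeasure A ΔA φ)⟫_ℂ / ((‖φ‖ ^ 2 : ℝ) : ℂ)
        = ∫ b in Δ, QJP.condMeasure A φ (e b) ΔA ∂(QJP.bornMeasure B φ)) ∧
    QJP.IsQuasiProbabilityKernel (QJP.condKernel A B e φ) ∧
    ∃ μ : ComplexMeasure (ℂ × ℝ),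
      QJP.IsKernelProduct (QJP.condKernel A B e φ) (QJP.bornMeasure B φ) μ ∧
      QJP.Represents μ (QJP.auxDistribution A B φ) ∧
      ∀ α : ℂ, QJP.Represents (μ.map (QJP.paramMapProd α))
        (QJP.convolutiveDistribution A B φ α) := by
  set S : Finset ℝ := (hfin.preimage Complex.ofReal_injective.injOn).toFinset with hSdef
  have hmem : ∀ b : ℝ, b ∈ S ↔ (b : ℂ) ∈ QJP.spectrum B := fun b => by simp [hSdef]
  have hS := QJP.isEigenbasis_of_isSelfAdjoint hB hfin hnondeg he hmem
  have hov' : ∀ b ∈ S, ⟪e b, φ⟫_ℂ ≠ 0 := fun b hb => hov b ((hmem b).1 hb)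
  exact ⟨fun Δ ΔA hΔ _ => QJP.inner_spectralMeasure_eq_setIntegral hS hov' hΔ ΔA,
    QJP.isQuasiProbabilityKernel_condKernel hmem hov', QJP.jointMeasure A S e φ,
    QJP.isKernelProduct_jointMeasure hS hφ (fun b hb => (hmem b).1 hb) hov',
    QJP.represents_jointMeasure hS hφ hov', QJP.represents_map_jointMeasure hS hφ hov'⟩
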